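/- **Theorem 1 (Soundness of the dAL proof calculus).** *Syntax.* Let $\mathcal V$ be a countably infinite set of variables, closed under $x\mapsto x'$, all of whose members are independent (freely generated by $'$ from base variables). Terms: $e,g ::= c\in\mathbb Q\mid x\mid e+g\mid e\cdot g\mid (e)'$. Real-arithmetic formulas: $F ::= e\le g\mid\neg F\mid F\wedge G\mid\forall x\,F$. Programs: $\alpha ::= x:=e\mid\ ?Q\mid\{X:F\}\mid\alpha\cup\beta\mid\alpha;\beta\mid\alpha^*$ with $Q,F$ real-arithmetic and $X$ a finite tuple of variables. Formulas: $P ::= e\le g\mid\neg P\mid P\wedge Q\mid\forall x\,P\mid[\alpha]P\mid\alpha\le_X\beta$. Here $=,<,\neq,\to,\leftrightarrow,\exists$ and vector equations are the usual abbreviations, and $X'$ is the tuple of the $x'$ with $x\in X$. *Semantics.* A state is a map $\sigma:\mathcal V\to\mathbb R$; the value of $(e)'$ at $\sigma$ is $\sum_{v\in\mathcal V}\sigma(v')\,\partial e/\partial v(\sigma)$. A trace of duration $T\ge 0$ is a map from $[0,T]$ to states. It is $X$-regular if its $X$-components are $C^1$ on $[0,T]$ (one-sided at the end points, no condition if $T=0$)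 with derivative equal to the $X'$-components, and all variables outside $X\cup X'$ are constant. From $\sigma$, the program $x:=e$ has the single point trace at $\sigma$ with $x$ updated to the value of $e$; $?Q$ has the point trace at $\sigma$ if $\sigma\models Q$ and no trace otherwise; $\{X:F\}$ has all $X$-regular traces that start in $\sigma$ and satisfy $F$ at all times; $\alpha\cup\beta$ has the union; $\alpha;\beta$ has the concatenations $\varphi\cdot\psi$ ($\varphi$ on $[0,T_\varphi)$, then $\psi$ shifted) of a trace $\varphi$ of $\alpha$ from $\sigma$ with a trace $\psi$ of $\beta$ from the final state of $\varphi$; $\alpha^*$ has the finite iterations. $[\alpha]P$ holds in $\sigma$ if $P$ holds in the final state of every trace of $\alpha$ from $\sigma$; $\alpha\le_X\beta$ holds in $\sigma$ if for every trace of $\alpha$ from $\sigma$ there is a trace of $\beta$ from $\sigma$ with the same duration and the same values of $X$ and $X'$ at all times. A formula is valid if it holds in every state, a sequent $\Gamma\vdash\Delta$ if in every state satisfying all of $\Gamma$ some formula of $\Delta$ holds. $FV$ and $BV$ are the usual syntactic free and bound variables, with $BV(\{X:F\})=X\cup X'$, $FV(\{X:F\})=X\cup X'\cup FV(F)$ and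 $FV(\alpha\le_X\beta)=FV(\alpha)\cup FV(\beta)\cup X\cup X'$. *Axioms.* Below, $\preceq$ is $\le$ or $<$, and $J_X(e)=(\partial e_i/\partial x_j)$ and $\det$ are the syntactic Jacobian (of term vectors without the operator $(\cdot)'$) and the syntactic determinant. "$e$ is over $X$" means $FV(e)\subseteq X$. More generally $e$ may also contain parameters $p$ with $p,p'\notin X\cup X'$; then the axiom is prefixed with the hypotheses $p'=0$ for these parameters. "$Z$ is fresh for $X$" means that the variables in $Z,Z'$ are pairwise distinct and not in $X\cup X'$. 1. Differential terms: $(x)'=x'$, $(c)'=0$, $(e+g)'=(e)'+(g)'$, $(e\cdot g)'=(e)'\cdot g+e\cdot(g)'$. 2. Jacobian: $(e)'=J_X(e)\,X'$, for a term vector $e$ over a tuple $X$ of distinct variables. 3. Refinement: $\alpha\le_X\beta\to([\beta]P\to[\alpha]P)$ if $FV(P)\subseteq X\cup(BV(\alpha)\cup BV(\beta))^\complement$; and $\alpha\le_X\beta\to(\beta\le_X\gamma\to\alpha\le_X\gamma)$. 4. Differential weakening: $[\{X:F\}]F$. 5. Differential induction: $e\preceq0\to[\{X:(e)'\le0\}]\,e\preceq0$,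 for $e$ over $X$. 6. Differential hidden constraint: $(e)'=0\to[\{X:e=0\}]\,(e)'=0$, for $e$ over $X$. 7. Algebraic ghost: $[\{X:F\}](e=0\wedge\det J_{X'}(e)\ne0)\to\exists Z\,\exists Z'\,\bigl(\{X:F\}\le_X\{X,Z:F\wedge Z=g\}\bigr)$, where $e$ has as many components as $X$, $Z$ is fresh for $X$, and $Z,Z'$ are not free in $F,g$. 8. Differential ghost: $[\{X:F\}]\det A\ne0\to\forall Z\,\exists Z'\,\bigl(\{X:F\}\le_X\{X,Z:F\wedge AZ'=BZ+c\}\bigr)$, where $Z$ is fresh for $X$ and $Z,Z'$ are not free in $F,A,B,c$. 9. Differential cut: $[\{X:F\}]R\to\{X:F\}\le_X\{X:R\}$ and $[\{X:F\}]R\to\{X:F\}\le_X\{X:F\wedge R\}$. 10. Differential refinement: $\forall Z\,\forall Z'\,\bigl(\{X,Z:R\wedge F\}\le_X\{X:F\}\bigr)$, where $Z,Z'$ are not free in $F$. 11. Differential monotonicity: $\{X:F\}\le_X\{X:G\}\to\{X:F\wedge R\}\le_X\{X:G\wedge R\}$. 12. Differential projection: $[\{X:\exists Y'\exists Y\,F\}]F\wedge[\{X,Y:\exists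 Y'\exists Y\,G\}]G\to\bigl(\{X:F\}\le_X\{X:G\}\to\{X,Y:F\}\le_{X,Y}\{X,Y:G\}\bigr)$. 13. The axioms inherited from dynamic logic: $[\alpha](P\to Q)\to([\alpha]P\to[\alpha]Q)$; $P\to[\alpha]P$ if $FV(P)\cap BV(\alpha)=\emptyset$; $[x:=e]P\leftrightarrow\forall x\,(x=e\to P)$ if $x\notin FV(e)$; $[?Q]P\leftrightarrow(Q\to P)$; $[\alpha\cup\beta]P\leftrightarrow[\alpha]P\wedge[\beta]P$; $[\alpha;\beta]P\leftrightarrow[\alpha][\beta]P$; $[\alpha^*]P\leftrightarrow P\wedge[\alpha][\alpha^*]P$; $[\alpha^*]P\leftrightarrow P\wedge[\alpha^*](P\to[\alpha]P)$; $\forall x\,P\to P$; $\forall x\,P\to[x:=e]P$; reflexivity of $=$ and its congruence for $+$, $\cdot$, $\le$. *Rules.* Use of an axiom; use of a valid real-arithmetic formula without the operator $(\cdot)'$; generalization (from $\vdash P$ infer $\Gamma\vdash[\alpha]P,\Delta$); and the classical first-order sequent rules (identity, weakening/exchange/contraction, cut, $\neg$, $\wedge$, and $\forall$ on the right with the usual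 variable condition). *Claim.* Every axiom is valid; every rule has a valid conclusion whenever its premises are valid; consequently every derivable sequent is valid. -/

import Mathlib

namespace DAL

/-! ### Syntax -/

/-- Variables. The set of variables is closed under `x ↦ x'`: the variable with name `k` and
order `i` is `x_k` carrying `i` primes; all of them are independent of each other. -/
@[ext]
structure Var where
  name : ℕ
  order : ℕ
deriving DecidableEq

/-- The differential variable `x'` of a variable `x`. -/
def Var.prime (x : Var) : Var := ⟨x.name, x.order + 1⟩

/-- Terms `c | x | e + g | e · g | (e)'`. -/
inductive Term where
  | const (c : ℚ)
  | var (x : Var)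
  | add (e g : Term)
  | mul (e g : Term)
  | diff (e : Term)

/-- Formulas of (first-order) real arithmetic. -/
inductive RA where
  | le (e g : Term)
  | neg (F : RA)
  | and (F G : RA)
  | all (x : Var) (F : RA)

/-- Programs `x := e | ?Q | {x : F} | α ∪ β | α ; β | α*`. -/
inductive Prog where
  | assign (x : Var) (e : Term)
  | test (Q : RA)
  | dap (X : List Var) (F : RA)
  | choice (α β : Prog)
  | seq (α β : Prog)
  | loop (α : Prog)

/-- Formulas; `ref X α β` is the partial refinement `α ≤_X β`. -/
inductive Form where
  | le (e g : Term)
  | neg (P : Form)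
  | and (P Q : Form)
  | all (x : Var) (P : Form)
  | box (α : Prog) (P : Form)
  | ref (X : List Var) (α β : Prog)

/-- Real-arithmetic formulas are formulas. -/
def RA.toForm : RA → Form
  | .le e g => .le e g
  | .neg F => .neg F.toForm
  | .and F G => .and F.toForm G.toForm
  | .all x F => .all x F.toForm

/-! Abbreviations. -/

def RA.top : RA := .le (.const 0) (.const 0)
def RA.eq (e g : Term) : RA := .and (.le e g) (.le g e)
def RA.lt (e g : Term) : RA := .neg (.le g e)
def RA.ne (e g : Term) : RA := .neg (RA.eq e g)
def RA.ex (x : Var) (F : RA) : RA := .neg (.all x (.neg F))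

/-- `∃ X F` for a tuple `X`. -/
def RA.exs (X : List Var) (F : RA) : RA := X.foldr RA.ex F

/-- The equation `e = g` between term vectors, i.e. the conjunction of its components. -/
def RA.vecEq {n : ℕ} (e g : Fin n → Term) : RA :=
  (List.ofFn fun i => RA.eq (e i) (g i)).foldr RA.and RA.top

def Form.imp (P Q : Form) : Form := .neg (.and P (.neg Q))
def Form.iff (P Q : Form) : Form := .and (P.imp Q) (Q.imp P)
def Form.ex (x : Var) (P : Form) : Form := .neg (.all x (.neg P))
def Form.alls (X : List Var) (P : Form) : Form := X.foldr Form.all P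
def Form.exs (X : List Var) (P : Form) : Form := X.foldr Form.ex P

/-- `X'` for a tuple `X`. -/
def primes (X : List Var) : List Var := X.map Var.prime

/-- The set of variables `X ∪ X'`. -/
def both (X : List Var) : Finset Var := X.toFinset ∪ (primes X).toFinset

/-- Sum of a vector of terms. -/
def Term.sum {n : ℕ} (f : Fin n → Term) : Term :=
  (List.ofFn f).foldr Term.add (.const 0)

/-- Product of a matrix of terms and a vector of terms. -/
def mulVec {m n : ℕ} (A : Matrix (Fin m) (Fin n) Term) (v : Fin n → Term) : Fin m → Term :=
  fun i => Term.sum fun j => .mul (A i j) (v j)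

/-- The term does not use the differential operator `( · )'`
(differential variables are allowed). -/
def Term.OpFree : Term → Prop
  | .const _ => True
  | .var _ => True
  | .add e g => e.OpFree ∧ g.OpFree
  | .mul e g => e.OpFree ∧ g.OpFree
  | .diff _ => False

def RA.OpFree : RA → Prop
  | .le e g => e.OpFree ∧ g.OpFree
  | .neg F => F.OpFree
  | .and F G => F.OpFree ∧ G.OpFree
  | .all _ F => F.OpFree

/-- Syntactic partial derivative. It is only used on terms without differential operator;
the last clause is a dummy value. -/
def Term.pd (x : Var) : Term → Term
  | .const _ => .const 0
  | .var y => if y = x then .const 1 else .const 0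
  | .add e g => .add (e.pd x) (g.pd x)
  | .mul e g => .add (.mul (e.pd x) g) (.mul e (g.pd x))
  | .diff _ => .const 0

/-- Syntactic Jacobian of the term vector `e` with respect to the tuple `X`. -/
def jac {m n : ℕ} (X : Fin n → Var) (e : Fin m → Term) : Matrix (Fin m) (Fin n) Term :=
  fun i j => (e i).pd (X j)

/-- Syntactic determinant (expansion along the first row). -/
def mdet : {n : ℕ} → Matrix (Fin n) (Fin n) Term → Term
  | 0, _ => .const 1
  | 1, A => A 0 0
  | _ + 2, A => Term.sum fun j =>
      .mul (.mul (.const ((-1) ^ (j : ℕ))) (A 0 j)) (mdet (A.submatrix Fin.succ j.succAbove))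

/-! ### Free and bound variables -/

def Term.fv : Term → Finset Var
  | .const _ => ∅
  | .var x => {x}
  | .add e g => e.fv ∪ g.fv
  | .mul e g => e.fv ∪ g.fv
  | .diff e => e.fv ∪ e.fv.image Var.prime

def RA.fv : RA → Finset Var
  | .le e g => e.fv ∪ g.fv
  | .neg F => F.fv
  | .and F G => F.fv ∪ G.fv
  | .all x F => F.fv.erase x

/-- Bound variables of a program. -/
def Prog.bv : Prog → Finset Var
  | .assign x _ => {x}
  | .test _ => ∅
  | .dap X _ => both X
  | .choice α β => α.bv ∪ β.bv
  | .seq α β => α.bv ∪ β.bv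
  | .loop α => α.bv

/-- Variables that are bound on every run of a program. -/
def Prog.mbv : Prog → Finset Var
  | .assign x _ => {x}
  | .test _ => ∅
  | .dap X _ => both X
  | .choice α β => α.mbv ∩ β.mbv
  | .seq α β => α.mbv ∪ β.mbv
  | .loop _ => ∅

/-- Free variables of a program. A differential-algebraic program reads the initial values of
both `X` and `X'`. -/
def Prog.fv : Prog → Finset Var
  | .assign _ e => e.fv
  | .test Q => Q.fv
  | .dap X F => both X ∪ F.fv
  | .choice α β => α.fv ∪ β.fv
  | .seq α β => α.fv ∪ (β.fv \ α.mbv)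
  | .loop α => α.fv

/-- Free variables of a formula. A refinement `α ≤_X β` compares the values of `X` and `X'` along
whole traces. -/
def Form.fv : Form → Finset Var
  | .le e g => e.fv ∪ g.fv
  | .neg P => P.fv
  | .and P Q => P.fv ∪ Q.fv
  | .all x P => P.fv.erase x
  | .box α P => α.fv ∪ (P.fv \ α.mbv)
  | .ref X α β => α.fv ∪ β.fv ∪ both X

/-! ### Semantics -/

noncomputable section

abbrev State := Var → ℝ

/-- Value of a term. The sum in the last clause ranges over all variables; only those that are free
in `e` contribute. -/
def Term.eval : Term → State → ℝ
  | .const c, _ => (c : ℝ)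
  | .var x, σ => σ x
  | .add e g, σ => e.eval σ + g.eval σ
  | .mul e g, σ => e.eval σ * g.eval σ
  | .diff e, σ =>
      ∑ᶠ v : Var, σ v.prime * deriv (fun r : ℝ => e.eval (Function.update σ v r)) (σ v)

def RA.sat : RA → State → Prop
  | .le e g, σ => e.eval σ ≤ g.eval σ
  | .neg F, σ => ¬ F.sat σ
  | .and F G, σ => F.sat σ ∧ G.sat σ
  | .all x F, σ => ∀ r : ℝ, F.sat (Function.update σ x r)

/-- A trace of duration `dur`: a map from `[0, dur]` to states. -/
structure Trace where
  dur : ℝ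
  dur_nonneg : 0 ≤ dur
  val : Set.Icc (0 : ℝ) dur → State

/-- Extension of a trace to the real line, constant outside `[0, dur]`. -/
def Trace.ext (φ : Trace) : ℝ → State := Set.IccExtend φ.dur_nonneg φ.val

def Trace.initial (φ : Trace) : State := φ.val ⟨0, le_refl 0, φ.dur_nonneg⟩

def Trace.final (φ : Trace) : State := φ.val ⟨φ.dur, φ.dur_nonneg, le_refl φ.dur⟩

/-- The trace of duration `0` at the state `σ`. -/
def Trace.point (σ : State) : Trace := ⟨0, le_refl 0, fun _ => σ⟩

/-- Concatenation: `φ` on `[0, T_φ)` and `ψ(t - T_φ)` on `[T_φ, T_φ + T_ψ]`. -/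
def Trace.concat (φ ψ : Trace) : Trace where
  dur := φ.dur + ψ.dur
  dur_nonneg := add_nonneg φ.dur_nonneg ψ.dur_nonneg
  val := fun t =>
    if h : t.1 < φ.dur then φ.val ⟨t.1, t.2.1, h.le⟩
    else ψ.val ⟨t.1 - φ.dur, sub_nonneg.mpr (not_lt.mp h), sub_le_iff_le_add'.mpr t.2.2⟩

/-- `X`-regular traces: the components in `X` are `C¹` on the closed interval (one-sided derivatives
at the end points) with derivative given by the differential variables, and everything outside
`X ∪ X'` is constant. For duration `0` the first two conditions hold trivially. -/
structure Trace.Regular (X : List Var) (φ : Trace) : Prop where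
  hasDeriv : ∀ x ∈ X, ∀ t ∈ Set.Icc (0 : ℝ) φ.dur,
    HasDerivWithinAt (fun s => φ.ext s x) (φ.ext t x.prime) (Set.Icc 0 φ.dur) t
  contDeriv : ∀ x ∈ X, ContinuousOn (fun s => φ.ext s x.prime) (Set.Icc 0 φ.dur)
  const : ∀ y, y ∉ both X → ∀ t, φ.val t y = φ.initial y

/-- Sequential composition of trace semantics. -/
def seqSem (A B : State → Set Trace) : State → Set Trace := fun σ =>
  {χ | ∃ φ ∈ A σ, ∃ ψ ∈ B φ.final, χ = φ.concat ψ}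

/-- `n`-fold repetition, `α⁰ = ?⊤` and `αⁿ⁺¹ = α ; αⁿ`. -/
def iterSem (A : State → Set Trace) : ℕ → State → Set Trace
  | 0 => fun σ => {Trace.point σ}
  | n + 1 => seqSem A (iterSem A n)

/-- Trace semantics of programs. -/
def Prog.sem : Prog → State → Set Trace
  | .assign x e => fun σ => {Trace.point (Function.update σ x (e.eval σ))}
  | .test Q => fun σ => {φ | φ = Trace.point σ ∧ Q.sat σ}
  | .dap X F => fun σ => {φ | φ.Regular X ∧ φ.initial = σ ∧ ∀ t, F.sat (φ.val t)}
  | .choice α β => fun σ => α.sem σ ∪ β.sem σ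
  | .seq α β => seqSem α.sem β.sem
  | .loop α => fun σ => ⋃ n : ℕ, iterSem α.sem n σ

/-- Two traces coincide on `X`: same duration, same values of the variables in `X` and of their
differential variables at all times. -/
def Coincide (X : List Var) (φ ψ : Trace) : Prop :=
  ∃ h : φ.dur = ψ.dur, ∀ x ∈ both X, ∀ t : Set.Icc (0 : ℝ) φ.dur,
    φ.val t x = ψ.val ⟨t.1, t.2.1, h ▸ t.2.2⟩ x

/-- Semantics of formulas. -/
def Form.sat : Form → State → Prop
  | .le e g, σ => e.eval σ ≤ g.eval σ
  | .neg P, σ => ¬ P.sat σ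
  | .and P Q, σ => P.sat σ ∧ Q.sat σ
  | .all x P, σ => ∀ r : ℝ, P.sat (Function.update σ x r)
  | .box α P, σ => ∀ φ ∈ α.sem σ, P.sat φ.final
  | .ref X α β, σ => ∀ φ ∈ α.sem σ, ∃ ψ ∈ β.sem σ, Coincide X φ ψ

def Form.Valid (P : Form) : Prop := ∀ σ : State, P.sat σ

end

/-! ### The proof calculus -/

/-- `Z` is a tuple of ghost variables for `X`: the variables in `Z, Z'` are pairwise distinct
and do not belong to `X ∪ X'`. -/
def Ghost (Z X : List Var) : Prop :=
  (Z ++ primes Z).Nodup ∧ Disjoint (both Z) (both X)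

/-- `p₁' = 0 → … → pₖ' = 0 → A`; this is `A` itself for the empty tuple. -/
def withParams (P : List Var) (A : Form) : Form :=
  P.foldr (fun p B => (RA.eq (.var p.prime) (.const 0)).toForm.imp B) A

/-- `e` is a term in the variables `X` and the parameters `P`, where the parameters and their
differential variables do not belong to `X ∪ X'`. -/
def TermIn (X P : List Var) (e : Term) : Prop :=
  e.fv ⊆ X.toFinset ∪ P.toFinset ∧ Disjoint (both P) (both X)

/-- The term vector `(x₁, …, xₙ)`. -/
def vars {n : ℕ} (X : Fin n → Var) : Fin n → Term := fun i => .var (X i)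

/-- The term vector `(x₁', …, xₙ')`. -/
def dvars {n : ℕ} (X : Fin n → Var) : Fin n → Term := fun i => .var (X i).prime

/-- The axioms of the calculus. -/
inductive Ax : Form → Prop
  -- differential terms
  | diffVar (x : Var) : Ax (RA.eq (.diff (.var x)) (.var x.prime)).toForm
  | diffConst (c : ℚ) : Ax (RA.eq (.diff (.const c)) (.const 0)).toForm
  | diffAdd (e g : Term) :
      Ax (RA.eq (.diff (.add e g)) (.add (.diff e) (.diff g))).toForm
  | diffMul (e g : Term) :
      Ax (RA.eq (.diff (.mul e g)) (.add (.mul (.diff e) g) (.mul e (.diff g)))).toForm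
  | jacobian {m n : ℕ} (X : Fin n → Var) (P : List Var) (e : Fin m → Term)
      (hX : Function.Injective X) (hop : ∀ i, (e i).OpFree)
      (he : ∀ i, TermIn (List.ofFn X) P (e i)) :
      Ax (withParams P (RA.vecEq (fun i => .diff (e i)) (mulVec (jac X e) (dvars X))).toForm)
  -- refinement
  | refBox (X : List Var) (α β : Prog) (P : Form)
      (h : ∀ v ∈ P.fv, v ∈ X ∨ v ∉ α.bv ∪ β.bv) :
      Ax ((Form.ref X α β).imp ((Form.box β P).imp (.box α P)))
  | refTrans (X : List Var) (α β γ : Prog) :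
      Ax ((Form.ref X α β).imp ((Form.ref X β γ).imp (.ref X α γ)))
  -- differential weakening
  | dW (X : List Var) (F : RA) : Ax (.box (.dap X F) F.toForm)
  -- differential induction, non-strict and strict
  | dIle (X P : List Var) (e : Term) (he : TermIn X P e) :
      Ax (withParams P ((RA.le e (.const 0)).toForm.imp
        (.box (.dap X (.le (.diff e) (.const 0))) (RA.le e (.const 0)).toForm)))
  | dIlt (X P : List Var) (e : Term) (he : TermIn X P e) :
      Ax (withParams P ((RA.lt e (.const 0)).toForm.imp
        (.box (.dap X (.le (.diff e) (.const 0))) (RA.lt e (.const 0)).toForm)))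
  -- differential hidden constraint
  | dHC (X P : List Var) (e : Term) (he : TermIn X P e) :
      Ax (withParams P ((RA.eq (.diff e) (.const 0)).toForm.imp
        (.box (.dap X (RA.eq e (.const 0))) (RA.eq (.diff e) (.const 0)).toForm)))
  -- algebraic ghost
  | aG {n m : ℕ} (X : Fin n → Var) (Z : Fin m → Var) (F : RA) (e : Fin n → Term)
      (g : Fin m → Term) (hop : ∀ i, (e i).OpFree)
      (hZ : Ghost (List.ofFn Z) (List.ofFn X))
      (hF : Disjoint (both (List.ofFn Z)) F.fv)
      (hg : ∀ i, Disjoint (both (List.ofFn Z)) (g i).fv) :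
      Ax ((Form.box (.dap (List.ofFn X) F)
            (RA.and (RA.vecEq e fun _ => .const 0)
              (RA.ne (mdet (jac (fun j => (X j).prime) e)) (.const 0))).toForm).imp
          (Form.exs (List.ofFn Z) (Form.exs (primes (List.ofFn Z))
            (.ref (List.ofFn X) (.dap (List.ofFn X) F)
              (.dap (List.ofFn X ++ List.ofFn Z) (.and F (RA.vecEq (vars Z) g)))))))
  -- differential ghost
  | dG {m : ℕ} (X : List Var) (Z : Fin m → Var) (F : RA)
      (A B : Matrix (Fin m) (Fin m) Term) (c : Fin m → Term)
      (hZ : Ghost (List.ofFn Z) X)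
      (hF : Disjoint (both (List.ofFn Z)) F.fv)
      (hA : ∀ i j, Disjoint (both (List.ofFn Z)) (A i j).fv)
      (hB : ∀ i j, Disjoint (both (List.ofFn Z)) (B i j).fv)
      (hc : ∀ i, Disjoint (both (List.ofFn Z)) (c i).fv) :
      Ax ((Form.box (.dap X F) (RA.ne (mdet A) (.const 0)).toForm).imp
          (Form.alls (List.ofFn Z) (Form.exs (primes (List.ofFn Z))
            (.ref X (.dap X F)
              (.dap (X ++ List.ofFn Z) (.and F
                (RA.vecEq (mulVec A (dvars Z))
                  fun i => .add (mulVec B (vars Z) i) (c i))))))))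
  -- differential cut, with the cut formula as the new constraint or added to the old one
  | dC (X : List Var) (F R : RA) :
      Ax ((Form.box (.dap X F) R.toForm).imp (.ref X (.dap X F) (.dap X R)))
  | dCand (X : List Var) (F R : RA) :
      Ax ((Form.box (.dap X F) R.toForm).imp (.ref X (.dap X F) (.dap X (.and F R))))
  -- differential refinement
  | dR (X Z : List Var) (F R : RA) (hF : Disjoint (both Z) F.fv) :
      Ax (Form.alls Z (Form.alls (primes Z)
        (.ref X (.dap (X ++ Z) (.and R F)) (.dap X F))))
  -- differential monotonicity
  | dM (X : List Var) (F G R : RA) :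
      Ax ((Form.ref X (.dap X F) (.dap X G)).imp
        (.ref X (.dap X (.and F R)) (.dap X (.and G R))))
  -- differential projection
  | dP (X Y : List Var) (F G : RA) :
      Ax ((Form.and (.box (.dap X (RA.exs (primes Y) (RA.exs Y F))) F.toForm)
            (.box (.dap (X ++ Y) (RA.exs (primes Y) (RA.exs Y G))) G.toForm)).imp
          ((Form.ref X (.dap X F) (.dap X G)).imp
            (.ref (X ++ Y) (.dap (X ++ Y) F) (.dap (X ++ Y) G))))
  -- box axioms of dynamic logic
  | boxK (α : Prog) (P Q : Form) :
      Ax ((Form.box α (P.imp Q)).imp ((Form.box α P).imp (.box α Q)))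
  | boxV (α : Prog) (P : Form) (h : Disjoint P.fv α.bv) : Ax (P.imp (.box α P))
  | boxAssign (x : Var) (e : Term) (P : Form) (h : x ∉ e.fv) :
      Ax ((Form.box (.assign x e) P).iff
        (.all x ((RA.eq (.var x) e).toForm.imp P)))
  | boxTest (Q : RA) (P : Form) : Ax ((Form.box (.test Q) P).iff (Q.toForm.imp P))
  | boxChoice (α β : Prog) (P : Form) :
      Ax ((Form.box (.choice α β) P).iff (.and (.box α P) (.box β P)))
  | boxSeq (α β : Prog) (P : Form) :
      Ax ((Form.box (.seq α β) P).iff (.box α (.box β P)))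
  | boxLoop (α : Prog) (P : Form) :
      Ax ((Form.box (.loop α) P).iff (.and P (.box α (.box (.loop α) P))))
  | boxInd (α : Prog) (P : Form) :
      Ax ((Form.box (.loop α) P).iff (.and P (.box (.loop α) (P.imp (.box α P)))))
  -- quantifier instantiation and equality
  | allElim (x : Var) (P : Form) : Ax ((Form.all x P).imp P)
  | allInst (x : Var) (e : Term) (P : Form) : Ax ((Form.all x P).imp (.box (.assign x e) P))
  | eqRefl (e : Term) : Ax (RA.eq e e).toForm
  | leCongr (e e₁ g g₁ : Term) :
      Ax ((RA.eq e e₁).toForm.imp ((RA.eq g g₁).toForm.imp ((Form.le e g).imp (.le e₁ g₁))))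
  | addCongr (e e₁ g g₁ : Term) :
      Ax ((RA.eq e e₁).toForm.imp ((RA.eq g g₁).toForm.imp
        (RA.eq (.add e g) (.add e₁ g₁)).toForm))
  | mulCongr (e e₁ g g₁ : Term) :
      Ax ((RA.eq e e₁).toForm.imp ((RA.eq g g₁).toForm.imp
        (RA.eq (.mul e g) (.mul e₁ g₁)).toForm))

/-- A sequent `Γ ⊢ Δ`. -/
structure Sequent where
  ante : List Form
  succ : List Form

/-- A sequent is valid if in every state in which all formulas of `Γ` hold, some formula
of `Δ` holds. -/
def Sequent.Valid (s : Sequent) : Prop :=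
  ∀ σ : State, (∀ P ∈ s.ante, P.sat σ) → ∃ P ∈ s.succ, P.sat σ

/-- The proof rules: `Rule ps s` says that `s` follows in one step from the premises `ps`. -/
inductive Rule : List Sequent → Sequent → Prop
  | ax (P : Form) (h : Ax P) (Γ Δ : List Form) : Rule [] ⟨Γ, P :: Δ⟩
  -- valid formulas of real arithmetic
  | real (F : RA) (hop : F.OpFree) (h : ∀ σ, F.sat σ) (Γ Δ : List Form) :
      Rule [] ⟨Γ, F.toForm :: Δ⟩
  -- Gödel generalization
  | gen (α : Prog) (P : Form) (Γ Δ : List Form) : Rule [⟨[], [P]⟩] ⟨Γ, .box α P :: Δ⟩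
  -- first-order sequent calculus
  | id (P : Form) (Γ Δ : List Form) : Rule [] ⟨P :: Γ, P :: Δ⟩
  | weaken (Γ Δ Γ₁ Δ₁ : List Form) (hΓ : Γ ⊆ Γ₁) (hΔ : Δ ⊆ Δ₁) : Rule [⟨Γ, Δ⟩] ⟨Γ₁, Δ₁⟩
  | cut (P : Form) (Γ Δ : List Form) : Rule [⟨Γ, P :: Δ⟩, ⟨P :: Γ, Δ⟩] ⟨Γ, Δ⟩
  | negL (P : Form) (Γ Δ : List Form) : Rule [⟨Γ, P :: Δ⟩] ⟨.neg P :: Γ, Δ⟩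
  | negR (P : Form) (Γ Δ : List Form) : Rule [⟨P :: Γ, Δ⟩] ⟨Γ, .neg P :: Δ⟩
  | andL (P Q : Form) (Γ Δ : List Form) : Rule [⟨P :: Q :: Γ, Δ⟩] ⟨.and P Q :: Γ, Δ⟩
  | andR (P Q : Form) (Γ Δ : List Form) :
      Rule [⟨Γ, P :: Δ⟩, ⟨Γ, Q :: Δ⟩] ⟨Γ, .and P Q :: Δ⟩
  | allR (x : Var) (P : Form) (Γ Δ : List Form) (hΓ : ∀ Q ∈ Γ, x ∉ Q.fv)
      (hΔ : ∀ Q ∈ Δ, x ∉ Q.fv) : Rule [⟨Γ, P :: Δ⟩] ⟨Γ, .all x P :: Δ⟩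

/-- Derivability in the calculus. -/
inductive Provable : Sequent → Prop
  | step (ps : List Sequent) (s : Sequent) (h : Rule ps s) (hp : ∀ p ∈ ps, Provable p) :
      Provable s

end DAL

/-! Validity of a sequent passes through each rule, so soundness is an induction on derivations over
the validity of the axioms and the soundness of single rules. The only delicate rule is the
universal quantifier on the right, which needs the coincidence lemmas `Prog.sem_coincidence` and
`Form.sat_of_agree`.

Every term, even with nested differential operators, denotes a polynomial in finitely many
variables, and `(e)'` is the derivation that sends each `v` to `v'` (`Term.eval_eq_poly`). This
settles the differential term axioms and gives the chain rule along a trace: `(e)'` is the time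
derivative of `e`. Differential induction is then monotonicity, and the hidden constraint is
uniqueness of one-sided derivatives.

Traces of differential-algebraic programs are handled as curves on the real line (`DapCurve`),
closed under restriction to a prefix and under freezing or adding variables. Cut, refinement,
monotonicity and projection need no more than this.

The ghost axioms need analysis. For a differential ghost, invertibility of `A` turns the new
constraint into a linear equation `Z' = A⁻¹(BZ + c)` with continuous coefficients, solvable on the
whole interval (`exists_solution_of_linear`). For an algebraic ghost, `Z = g` must be C¹ although
`g` may mention `X'`, which is only continuous along a trace. The invertible Jacobian of `e` in `X'`
supplies the missing differentiability: exact difference quotients of polynomials satisfy a linear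
system whose limit can be solved (`hasDerivWithinAt_of_implicit`). The resulting rate is a function
of the current state, so the initial value of `Z'` can be chosen before the trace is known. -/

namespace DAL

noncomputable section

open MvPolynomial

/-! ### Terms as polynomial functions -/

/-- The polynomial denoted by a term. -/
def Term.poly : Term → MvPolynomial Var ℝ
  | .const c => C (c : ℝ)
  | .var x => X x
  | .add e g => e.poly + g.poly
  | .mul e g => e.poly * g.poly
  | .diff e => mkDerivation ℝ (fun v : Var => (X v.prime : MvPolynomial Var ℝ)) e.poly

/-- Chain rule for a polynomial along a curve all of whose components are differentiable. -/
theorem hasDerivWithinAt_eval_poly {f : ℝ → State} {d : Var → ℝ} {s : Set ℝ} {t : ℝ}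
    (h : ∀ v, HasDerivWithinAt (fun r => f r v) (d v) s t) (p : MvPolynomial Var ℝ) :
    HasDerivWithinAt (fun r => MvPolynomial.eval (f r) p)
      (MvPolynomial.eval (f t) (mkDerivation ℝ (fun v => (C (d v) : MvPolynomial Var ℝ)) p)) s t := by
  induction p using MvPolynomial.induction_on with
  | C a => simpa using hasDerivWithinAt_const t s a
  | add p q hp hq =>
    simp only [map_add]
    exact hp.add hq
  | mul_X p v hp =>
    have := hp.mul (h v)
    simp only [map_mul, eval_X, Derivation.leibniz, mkDerivation_X, smul_eq_mul, map_add, eval_C]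
    refine this.congr_deriv ?_
    ring

/-- A derivation is determined by its values on the variables that occur. -/
theorem eval_mkDerivation (σ : State) (h : Var → MvPolynomial Var ℝ) (p : MvPolynomial Var ℝ)
    {S : Finset Var} (hS : p.vars ⊆ S) :
    MvPolynomial.eval σ (mkDerivation ℝ h p) =
      ∑ v ∈ S, MvPolynomial.eval σ (h v) * MvPolynomial.eval σ (pderiv v p) := by
  have hsum : ∀ q : MvPolynomial Var ℝ,
      (∑ v ∈ S, h v • pderiv (R := ℝ) v) q = ∑ v ∈ S, h v • pderiv v q := fun q =>
    (congrFun (map_sum Derivation.coeFnAddMonoidHom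
      (fun v => h v • pderiv (R := ℝ) v) S) q).trans (Finset.sum_apply _ _ _)
  -- Two derivations agree on `p` once they agree on each variable of `p`.
  have key : mkDerivation ℝ h p = (∑ v ∈ S, h v • pderiv (R := ℝ) v) p := by
    refine derivation_eq_of_forall_mem_vars fun i hi => ?_
    rw [mkDerivation_X, hsum, Finset.sum_eq_single i]
    · simp
    · intro b _ hb
      simp [pderiv_X_of_ne hb.symm]
    · exact fun hn => absurd (hS hi) hn
  rw [key, hsum, map_sum]
  simp

/-- The line through `σ` in direction `v` has velocity 1 at `v` and 0 elsewhere; the derivation with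
these values is `pderiv v`. -/
theorem deriv_eval_update (σ : State) (v : Var) (p : MvPolynomial Var ℝ) :
    deriv (fun r : ℝ => MvPolynomial.eval (Function.update σ v r) p) (σ v) =
      MvPolynomial.eval σ (pderiv v p) := by
  have h := hasDerivWithinAt_eval_poly (f := fun r => Function.update σ v r)
    (d := Pi.single v 1) (s := Set.univ) (t := σ v) (fun w => by
      by_cases hw : w = v
      · subst hw
        simpa using hasDerivAt_id' (σ w)
      · simpa [hw] using hasDerivWithinAt_const (σ v) Set.univ (σ w)) p
  rw [hasDerivWithinAt_univ] at h
  rw [h.deriv, Function.update_eq_self, pderiv_def]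
  congr 3
  funext w
  by_cases hw : w = v
  · subst hw; simp
  · simp [hw]

/-- This ties the analytic meaning of `(e)'` to algebra: continuity, the chain rule and the Leibniz
rule for terms are all read off from polynomials. -/
theorem Term.eval_eq_poly (e : Term) (σ : State) : e.eval σ = MvPolynomial.eval σ e.poly := by
  induction e generalizing σ with
  | const c => simp [Term.eval, Term.poly]
  | var x => simp [Term.eval, Term.poly]
  | add e g he hg => simp [Term.eval, Term.poly, he, hg]
  | mul e g he hg => simp [Term.eval, Term.poly, he, hg]
  | diff e he =>
    simp only [Term.eval, Term.poly, he, deriv_eval_update]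
    rw [eval_mkDerivation σ _ _ subset_rfl, finsum_eq_sum_of_support_subset (s := e.poly.vars)]
    · simp
    · intro v hv
      by_contra hn
      exact hv (by simp [pderiv_eq_zero_of_notMem_vars (by simpa using hn)])

theorem Term.continuous_eval (e : Term) : Continuous e.eval := by
  simp only [funext e.eval_eq_poly]
  exact MvPolynomial.continuous_eval _

/-- Semantic partial derivative of a term. -/
def Term.partialAt (e : Term) (v : Var) (σ : State) : ℝ :=
  MvPolynomial.eval σ (pderiv v e.poly)

theorem Term.deriv_eval_update (e : Term) (v : Var) (σ : State) :
    deriv (fun r : ℝ => e.eval (Function.update σ v r)) (σ v) = e.partialAt v σ := by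
  simp only [Term.eval_eq_poly, DAL.deriv_eval_update, Term.partialAt]

theorem Term.continuous_partialAt (e : Term) (v : Var) : Continuous (e.partialAt v) :=
  MvPolynomial.continuous_eval _

/-- The value of a term depends only on its free variables. -/
theorem Term.eval_congr (e : Term) {σ τ : State} (h : ∀ v ∈ e.fv, σ v = τ v) :
    e.eval σ = e.eval τ := by
  induction e generalizing σ τ with
  | const c => rfl
  | var x => exact h x (by simp [Term.fv])
  | add e g he hg =>
    simp only [Term.fv, Finset.mem_union] at h
    simp only [Term.eval, he fun v hv => h v (.inl hv), hg fun v hv => h v (.inr hv)]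
  | mul e g he hg =>
    simp only [Term.fv, Finset.mem_union] at h
    simp only [Term.eval, he fun v hv => h v (.inl hv), hg fun v hv => h v (.inr hv)]
  | diff e he =>
    simp only [Term.fv, Finset.mem_union, Finset.mem_image] at h
    simp only [Term.eval]
    refine finsum_congr fun v => ?_
    by_cases hv : v ∈ e.fv
    · rw [h v.prime (.inr ⟨v, hv, rfl⟩), h v (.inl hv)]
      congr 2
      funext r
      refine he fun w hw => ?_
      by_cases hwv : w = v
      · subst hwv; simp
      · simp [hwv, h w (.inl hw)]
    -- Here `v'` need not be free in `(e)'`, so the states may differ on it; its coefficient, a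
    -- partial derivative in a variable not free in `e`, is zero.
    · have hc : ∀ ρ : State, (fun r : ℝ => e.eval (Function.update ρ v r)) = fun _ => e.eval ρ :=
        fun ρ => funext fun r => he fun w hw => Function.update_of_ne (by grind) _ _
      simp [hc]

theorem Term.partialAt_eq_zero {e : Term} {v : Var} (hv : v ∉ e.fv) (σ : State) :
    e.partialAt v σ = 0 := by
  have hc : (fun r : ℝ => e.eval (Function.update σ v r)) = fun _ => e.eval σ :=
    funext fun r => e.eval_congr fun w hw => Function.update_of_ne (by grind) _ _
  rw [← e.deriv_eval_update, hc, deriv_const]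

theorem Term.eval_diff (e : Term) (σ : State) {S : Finset Var} (hS : e.fv ⊆ S) :
    (Term.diff e).eval σ = ∑ v ∈ S, σ v.prime * e.partialAt v σ := by
  simp only [Term.eval, e.deriv_eval_update]
  refine finsum_eq_sum_of_support_subset _ fun v hv => ?_
  by_contra hn
  exact hv (by simp [Term.partialAt_eq_zero (fun h => hn (hS h))])

/-- Chain rule for a term along a curve. -/
theorem Term.hasDerivWithinAt_eval (e : Term) {f : ℝ → State} {d : Var → ℝ} {s : Set ℝ} {t : ℝ}
    {S : Finset Var} (hS : e.fv ⊆ S)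
    (h : ∀ v ∈ e.fv, HasDerivWithinAt (fun r => f r v) (d v) s t) :
    HasDerivWithinAt (fun r => e.eval (f r)) (∑ v ∈ S, d v * e.partialAt v (f t)) s t := by
  -- Components not free in `e` need not be differentiable. Freezing them at time `t` makes the
  -- polynomial chain rule applicable without changing `e`.
  let g : ℝ → State := fun r v => if v ∈ e.fv then f r v else f t v
  have hgt : g t = f t := by funext v; simp [g]
  have hg := hasDerivWithinAt_eval_poly (f := g) (d := fun v => if v ∈ e.fv then d v else 0)
    (s := s) (t := t) (fun v => by
      by_cases hv : v ∈ e.fv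
      · simpa [g, hv] using h v hv
      · simpa [g, hv] using hasDerivWithinAt_const t s (f t v)) e.poly
  -- The sum runs over a union because `e.poly.vars` and `S` are not compared; superfluous summands
  -- vanish.
  rw [eval_mkDerivation _ _ _ (Finset.subset_union_left (s₂ := S)), hgt] at hg
  have hfun : (fun r => e.eval (f r)) = fun r => MvPolynomial.eval (g r) e.poly := by
    funext r
    rw [← e.eval_eq_poly]
    exact e.eval_congr fun v hv => by simp [g, hv]
  rw [hfun]
  convert hg using 1
  rw [← Finset.sum_subset (Finset.subset_union_right (s₁ := e.poly.vars))]
  · refine Finset.sum_congr rfl fun v _ => ?_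
    by_cases hv : v ∈ e.fv
    · simp [hv, Term.partialAt]
    · simp [hv, Term.partialAt_eq_zero hv]
  · intro v _ hv
    have hn : v ∉ e.fv := fun h => hv (hS h)
    simp [hn]

/-! ### Syntactic derivatives and exact difference quotients. -/

theorem Term.eval_pd {e : Term} (he : e.OpFree) (v : Var) (σ : State) :
    (e.pd v).eval σ = e.partialAt v σ := by
  induction e with
  | const c => simp [Term.pd, Term.eval, Term.partialAt, Term.poly]
  | var x =>
    by_cases h : x = v
    · simp [Term.pd, Term.eval, Term.partialAt, Term.poly, h]
    · simp [Term.pd, Term.eval, Term.partialAt, Term.poly, h, pderiv_X_of_ne h]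
  | add e g ihe ihg =>
    simp [Term.pd, Term.eval, Term.partialAt, Term.poly, ihe he.1, ihg he.2]
  | mul e g ihe ihg =>
    simp only [Term.pd, Term.eval, ihe he.1, ihg he.2]
    simp only [Term.partialAt, Term.poly, Term.eval_eq_poly, pderiv_mul, map_add, map_mul]
  | diff e => exact he.elim

/-- Difference quotient of an operator-free term in direction `v`, between the states `a`
and `b`. -/
def Term.quot (v : Var) : Term → State → State → ℝ
  | .const _, _, _ => 0
  | .var y, _, _ => if y = v then 1 else 0
  | .add e g, a, b => e.quot v a b + g.quot v a b
  -- Discrete Leibniz rule: `e(b)g(b) - e(a)g(a) = (e(b) - e(a))g(b) + e(a)(g(b) - g(a))`.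
  | .mul e g, a, b => e.quot v a b * g.eval b + e.eval a * g.quot v a b
  | .diff _, _, _ => 0

/-- A first-order expansion without remainder: the error is absorbed into coefficients that depend
continuously on `b` and become the partial derivatives at `b = a`. -/
theorem Term.eval_sub_eval {e : Term} (he : e.OpFree) (a b : State) {S : Finset Var}
    (hS : e.fv ⊆ S) : e.eval b - e.eval a = ∑ v ∈ S, (b v - a v) * e.quot v a b := by
  induction e with
  | const c => simp [Term.eval, Term.quot]
  | var x =>
    have hx : x ∈ S := hS (by simp [Term.fv])
    simp [Term.eval, Term.quot, hx]
  | add e g ihe ihg =>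
    have h := Finset.union_subset_iff.1 hS
    have := ihe he.1 h.1
    have := ihg he.2 h.2
    simp only [Term.eval, Term.quot, mul_add, Finset.sum_add_distrib]
    linarith
  | mul e g ihe ihg =>
    have h := Finset.union_subset_iff.1 hS
    have h1 := ihe he.1 h.1
    have h2 := ihg he.2 h.2
    simp only [Term.eval, Term.quot, mul_add, Finset.sum_add_distrib]
    simp only [← mul_assoc, ← Finset.sum_mul, mul_right_comm _ (Term.eval e a)]
    rw [← h1, ← h2]
    ring
  | diff e => exact he.elim

theorem Term.quot_self {e : Term} (he : e.OpFree) (v : Var) (a : State) :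
    e.quot v a a = (e.pd v).eval a := by
  induction e with
  | const c => simp [Term.pd, Term.eval, Term.quot]
  | var x => by_cases h : x = v <;> simp [Term.pd, Term.eval, Term.quot, h]
  | add e g ihe ihg => simp [Term.pd, Term.eval, Term.quot, ihe he.1, ihg he.2]
  | mul e g ihe ihg => simp [Term.pd, Term.eval, Term.quot, ihe he.1, ihg he.2]
  | diff e => exact he.elim

theorem Term.continuous_quot (e : Term) (v : Var) (a : State) : Continuous (e.quot v a) := by
  induction e with
  | const c => exact continuous_const
  | var x => exact continuous_const
  | add e g ihe ihg => exact ihe.add ihg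
  | mul e g ihe ihg => exact (ihe.mul g.continuous_eval).add (continuous_const.mul ihg)
  | diff e => exact continuous_const

/-! ### Values of sums, products and determinants of terms. -/

theorem Term.eval_sum {n : ℕ} (f : Fin n → Term) (σ : State) :
    (Term.sum f).eval σ = ∑ i, (f i).eval σ := by
  induction n with
  | zero => simp [Term.sum, Term.eval]
  | succ n ih =>
    have := ih fun i => f i.succ
    simp only [Term.sum] at this
    rw [Fin.sum_univ_succ, ← this]
    simp [Term.sum, List.ofFn_succ, Term.eval]

theorem eval_mulVec {m n : ℕ} (A : Matrix (Fin m) (Fin n) Term) (v : Fin n → Term) (i : Fin m)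
    (σ : State) : (mulVec A v i).eval σ = ∑ j, (A i j).eval σ * (v j).eval σ := by
  simp [mulVec, Term.eval_sum, Term.eval]

/-- The matrix of values of a matrix of terms. -/
def evalMat {m n : ℕ} (A : Matrix (Fin m) (Fin n) Term) (σ : State) : Matrix (Fin m) (Fin n) ℝ :=
  Matrix.of fun i j => (A i j).eval σ

theorem eval_mdet {n : ℕ} (A : Matrix (Fin n) (Fin n) Term) (σ : State) :
    (mdet A).eval σ = (evalMat A σ).det := by
  induction n with
  | zero => simp [mdet, Term.eval]
  | succ n ih =>
    cases n with
    | zero => simp [mdet, evalMat]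
    | succ n =>
      rw [mdet, Term.eval_sum, Matrix.det_succ_row_zero]
      refine Finset.sum_congr rfl fun j _ => ?_
      simp only [Term.eval, ih]
      push_cast
      rfl

theorem continuous_evalMat {m n : ℕ} (A : Matrix (Fin m) (Fin n) Term) :
    Continuous (evalMat A) :=
  continuous_matrix fun i j => (A i j).continuous_eval

end

end DAL

namespace DAL

noncomputable section

/-! ### Satisfaction of the abbreviations -/

theorem RA.sat_toForm (F : RA) (σ : State) : F.toForm.sat σ ↔ F.sat σ := by
  induction F generalizing σ with
  | le e g => rfl
  | neg F ih => simp [RA.toForm, Form.sat, RA.sat, ih]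
  | and F G ihF ihG => simp [RA.toForm, Form.sat, RA.sat, ihF, ihG]
  | all x F ih => simp [RA.toForm, Form.sat, RA.sat, ih]

theorem RA.sat_congr {F : RA} {σ τ : State} (h : ∀ v ∈ F.fv, σ v = τ v) : F.sat σ ↔ F.sat τ := by
  induction F generalizing σ τ with
  | le e g =>
    simp only [RA.fv, Finset.mem_union] at h
    simp only [RA.sat, e.eval_congr fun v hv => h v (.inl hv),
      g.eval_congr fun v hv => h v (.inr hv)]
  | neg F ih => exact not_congr (ih h)
  | and F G ihF ihG =>
    simp only [RA.fv, Finset.mem_union] at h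
    exact and_congr (ihF fun v hv => h v (.inl hv)) (ihG fun v hv => h v (.inr hv))
  | all x F ih =>
    refine forall_congr' fun r => ih fun v hv => ?_
    by_cases hvx : v = x
    · subst hvx; simp
    · simpa [hvx] using h v (by simp [RA.fv, hvx, hv])

@[simp] theorem RA.sat_and (F G : RA) (σ : State) : (RA.and F G).sat σ ↔ F.sat σ ∧ G.sat σ :=
  Iff.rfl

@[simp] theorem RA.sat_eq (e g : Term) (σ : State) : (RA.eq e g).sat σ ↔ e.eval σ = g.eval σ :=
  le_antisymm_iff.symm

@[simp] theorem RA.sat_lt (e g : Term) (σ : State) : (RA.lt e g).sat σ ↔ e.eval σ < g.eval σ :=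
  not_le

@[simp] theorem RA.sat_ne (e g : Term) (σ : State) : (RA.ne e g).sat σ ↔ e.eval σ ≠ g.eval σ :=
  not_congr (RA.sat_eq e g σ)

@[simp] theorem RA.sat_vecEq {n : ℕ} (e g : Fin n → Term) (σ : State) :
    (RA.vecEq e g).sat σ ↔ ∀ i, (e i).eval σ = (g i).eval σ := by
  induction n with
  | zero => simp [RA.vecEq, RA.top, RA.sat]
  | succ n ih =>
    have := ih (fun i => e i.succ) fun i => g i.succ
    simp only [RA.vecEq] at this
    simp [RA.vecEq, List.ofFn_succ, this, Fin.forall_fin_succ]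

theorem RA.sat_ex (x : Var) (F : RA) (σ : State) :
    (RA.ex x F).sat σ ↔ ∃ r : ℝ, F.sat (Function.update σ x r) := by
  simp [RA.ex, RA.sat]

/-- A block of quantifiers becomes one quantifier over states, so neither the order nor repetitions
in the tuple matter. -/
theorem RA.sat_exs (L : List Var) (F : RA) (σ : State) :
    (RA.exs L F).sat σ ↔ ∃ ρ : State, (∀ v ∉ L, ρ v = σ v) ∧ F.sat ρ := by
  induction L generalizing σ with
  | nil =>
    refine ⟨fun h => ⟨σ, fun _ _ => rfl, h⟩, fun ⟨ρ, h, hF⟩ => ?_⟩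
    obtain rfl : ρ = σ := funext fun v => h v (by simp)
    exact hF
  | cons x L ih =>
    change (RA.ex x (RA.exs L F)).sat σ ↔ _
    simp only [RA.sat_ex, ih]
    constructor
    · rintro ⟨r, ρ, h, hF⟩
      refine ⟨ρ, fun v hv => ?_, hF⟩
      rw [h v (by simp_all), Function.update_of_ne (by simp_all)]
    · rintro ⟨ρ, h, hF⟩
      refine ⟨ρ x, ρ, fun v hv => ?_, hF⟩
      by_cases hvx : v = x
      · subst hvx; simp
      · simpa [hvx] using h v (by simp [hvx, hv])

@[simp] theorem Form.sat_imp (P Q : Form) (σ : State) :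
    (P.imp Q).sat σ ↔ (P.sat σ → Q.sat σ) := by
  simp [Form.imp, Form.sat]

@[simp] theorem Form.sat_iff (P Q : Form) (σ : State) :
    (P.iff Q).sat σ ↔ (P.sat σ ↔ Q.sat σ) := by
  simp only [Form.iff, Form.sat, Form.sat_imp]
  exact iff_iff_implies_and_implies.symm

theorem Form.sat_alls (L : List Var) (P : Form) (σ : State) :
    (Form.alls L P).sat σ ↔ ∀ ρ : State, (∀ v ∉ L, ρ v = σ v) → P.sat ρ := by
  induction L generalizing σ with
  | nil =>
    refine ⟨fun h ρ hρ => ?_, fun h => h σ fun _ _ => rfl⟩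
    obtain rfl : ρ = σ := funext fun v => hρ v (by simp)
    exact h
  | cons x L ih =>
    change (∀ r : ℝ, (Form.alls L P).sat (Function.update σ x r)) ↔ _
    simp only [ih]
    constructor
    · intro h ρ hρ
      refine h (ρ x) ρ fun v hv => ?_
      by_cases hvx : v = x
      · subst hvx; simp
      · simpa [hvx] using hρ v (by simp [hvx, hv])
    · intro h r ρ hρ
      refine h ρ fun v hv => ?_
      rw [hρ v (by simp_all), Function.update_of_ne (by simp_all)]

theorem Form.sat_exs (L : List Var) (P : Form) (σ : State) :
    (Form.exs L P).sat σ ↔ ∃ ρ : State, (∀ v ∉ L, ρ v = σ v) ∧ P.sat ρ := by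
  have h : ∀ σ, (Form.exs L P).sat σ ↔ ¬ (Form.alls L (.neg P)).sat σ := by
    induction L with
    | nil => simp [Form.exs, Form.alls, Form.sat]
    | cons x L ih =>
      simp only [Form.exs, Form.alls] at ih
      simp [Form.exs, Form.alls, Form.ex, Form.sat, ih]
  rw [h, Form.sat_alls]
  simp [Form.sat]

theorem sat_withParams (P : List Var) (A : Form) (σ : State) :
    (withParams P A).sat σ ↔ ((∀ p ∈ P, σ p.prime = 0) → A.sat σ) := by
  induction P with
  | nil => simp [withParams]
  | cons p P ih =>
    simp only [withParams] at ih
    simp [withParams, ih, RA.sat_toForm, Term.eval]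

/-! ### Traces -/

/-- The trace of duration `T` given by a function on the real line. -/
def Trace.ofFun (T : ℝ) (hT : 0 ≤ T) (f : ℝ → State) : Trace := ⟨T, hT, fun t => f t.1⟩

theorem Trace.ext_of_mem (φ : Trace) {t : ℝ} (ht : t ∈ Set.Icc 0 φ.dur) : φ.ext t = φ.val ⟨t, ht⟩ :=
  Set.IccExtend_of_mem _ _ ht

theorem Trace.initial_eq_ext (φ : Trace) : φ.initial = φ.ext 0 :=
  (φ.ext_of_mem ⟨le_rfl, φ.dur_nonneg⟩).symm

theorem Trace.final_eq_ext (φ : Trace) : φ.final = φ.ext φ.dur :=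
  (φ.ext_of_mem ⟨φ.dur_nonneg, le_rfl⟩).symm

theorem Trace.ext_ofFun {T : ℝ} (hT : 0 ≤ T) (f : ℝ → State) {t : ℝ} (ht : t ∈ Set.Icc 0 T) :
    (Trace.ofFun T hT f).ext t = f t :=
  Trace.ext_of_mem (Trace.ofFun T hT f) ht

theorem Trace.ext_concat (φ ψ : Trace) {t : ℝ} (ht : t ∈ Set.Icc 0 (φ.dur + ψ.dur)) :
    (φ.concat ψ).ext t = if t < φ.dur then φ.ext t else ψ.ext (t - φ.dur) := by
  rw [Trace.ext_of_mem (φ.concat ψ) ht]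
  by_cases h : t < φ.dur
  · simp only [Trace.concat, h, dite_true, if_true]
    exact (φ.ext_of_mem _).symm
  · simp only [Trace.concat, h, dite_false, if_false]
    exact (ψ.ext_of_mem _).symm

theorem Trace.final_concat (φ ψ : Trace) : (φ.concat ψ).final = ψ.final := by
  have h := φ.ext_concat ψ (t := φ.dur + ψ.dur)
    ⟨add_nonneg φ.dur_nonneg ψ.dur_nonneg, le_rfl⟩
  -- At the junction the value of `ψ` counts, so even a `ψ` of duration 0 supplies the final state.
  rw [if_neg (by have := ψ.dur_nonneg; linarith), add_sub_cancel_left, ← ψ.final_eq_ext] at h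
  rw [Trace.final_eq_ext]
  exact h

/-- Two traces have the same duration and the same values of the variables in `V`. -/
def Trace.AgreeOn (V : Finset Var) (φ ψ : Trace) : Prop :=
  φ.dur = ψ.dur ∧ ∀ t ∈ Set.Icc 0 φ.dur, ∀ v ∈ V, φ.ext t v = ψ.ext t v

theorem Trace.AgreeOn.mono {V W : Finset Var} {φ ψ : Trace} (h : φ.AgreeOn V ψ) (hW : W ⊆ V) :
    φ.AgreeOn W ψ :=
  ⟨h.1, fun t ht v hv => h.2 t ht v (hW hv)⟩

theorem Trace.AgreeOn.trans {V : Finset Var} {φ ψ χ : Trace} (h : φ.AgreeOn V ψ)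
    (h' : ψ.AgreeOn V χ) : φ.AgreeOn V χ :=
  ⟨h.1.trans h'.1, fun t ht v hv => (h.2 t ht v hv).trans (h'.2 t (h.1 ▸ ht) v hv)⟩

theorem Trace.AgreeOn.final {V : Finset Var} {φ ψ : Trace} (h : φ.AgreeOn V ψ) {v : Var}
    (hv : v ∈ V) : φ.final v = ψ.final v := by
  rw [φ.final_eq_ext, ψ.final_eq_ext, ← h.1]
  exact h.2 _ ⟨φ.dur_nonneg, le_rfl⟩ v hv

theorem Trace.AgreeOn.concat {V : Finset Var} {φ φ' ψ ψ' : Trace} (h : φ.AgreeOn V φ')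
    (h' : ψ.AgreeOn V ψ') : (φ.concat ψ).AgreeOn V (φ'.concat ψ') := by
  have hd : φ.dur + ψ.dur = φ'.dur + ψ'.dur := by rw [h.1, h'.1]
  refine ⟨hd, fun t ht v hv => ?_⟩
  have ht0 : t ∈ Set.Icc 0 (φ.dur + ψ.dur) := ht
  rw [φ.ext_concat ψ ht0, φ'.ext_concat ψ' (hd ▸ ht0), ← h.1]
  split_ifs with hlt
  · exact h.2 t ⟨ht.1, hlt.le⟩ v hv
  · exact h'.2 _ ⟨sub_nonneg.2 (not_lt.1 hlt), by linarith [ht0.2]⟩ v hv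

theorem Trace.agreeOn_point {V : Finset Var} {σ τ : State} (h : ∀ v ∈ V, σ v = τ v) :
    (Trace.point σ).AgreeOn V (Trace.point τ) :=
  ⟨rfl, fun t ht v hv => by
    rw [Trace.ext_of_mem _ ht, Trace.ext_of_mem (Trace.point τ) ht]; exact h v hv⟩

/-- Passing to the extended traces removes the time intervals that depend on the trace, so
coincidences can be chained. -/
theorem coincide_iff (X : List Var) (φ ψ : Trace) : Coincide X φ ψ ↔ φ.AgreeOn (both X) ψ := by
  constructor
  · rintro ⟨h, hX⟩
    refine ⟨h, fun t ht v hv => ?_⟩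
    rw [φ.ext_of_mem ht, ψ.ext_of_mem (h ▸ ht)]
    exact hX v hv ⟨t, ht⟩
  · rintro ⟨h, hX⟩
    refine ⟨h, fun v hv t => ?_⟩
    have := hX t.1 t.2 v hv
    rwa [φ.ext_of_mem t.2, ψ.ext_of_mem (h ▸ t.2)] at this

/-! ### Traces of differential-algebraic programs -/

/-- The function `f` describes on `[0, T]` a trace of `{X : F}` from the state `σ`. -/
structure DapCurve (X : List Var) (F : RA) (σ : State) (T : ℝ) (f : ℝ → State) : Prop where
  nonneg : 0 ≤ T
  hasDeriv : ∀ x ∈ X, ∀ t ∈ Set.Icc 0 T,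
    HasDerivWithinAt (fun s => f s x) (f t x.prime) (Set.Icc 0 T) t
  contDeriv : ∀ x ∈ X, ContinuousOn (fun s => f s x.prime) (Set.Icc 0 T)
  const : ∀ y, y ∉ both X → ∀ t ∈ Set.Icc 0 T, f t y = σ y
  init : ∀ y ∈ both X, f 0 y = σ y
  sat : ∀ t ∈ Set.Icc 0 T, F.sat (f t)

theorem DapCurve.zero {X : List Var} {F : RA} {σ : State} {T : ℝ} {f : ℝ → State}
    (h : DapCurve X F σ T f) : f 0 = σ := by
  funext y
  by_cases hy : y ∈ both X
  · exact h.init y hy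
  · exact h.const y hy 0 ⟨le_rfl, h.nonneg⟩

theorem DapCurve.of_mem {X : List Var} {F : RA} {σ : State} {φ : Trace}
    (h : φ ∈ (Prog.dap X F).sem σ) : DapCurve X F σ φ.dur φ.ext where
  nonneg := φ.dur_nonneg
  hasDeriv := h.1.hasDeriv
  contDeriv := h.1.contDeriv
  const y hy t ht := by
    rw [φ.ext_of_mem ht, h.1.const y hy, h.2.1]
  init y _ := by rw [← φ.initial_eq_ext, h.2.1]
  sat t ht := by
    rw [φ.ext_of_mem ht]
    exact h.2.2 _

theorem DapCurve.ofFun_mem {X : List Var} {F : RA} {σ : State} {T : ℝ} {f : ℝ → State}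
    (h : DapCurve X F σ T f) : Trace.ofFun T h.nonneg f ∈ (Prog.dap X F).sem σ := by
  have hi : (Trace.ofFun T h.nonneg f).initial = σ := h.zero
  refine ⟨⟨fun x hx t ht => ?_, fun x hx => ?_, fun y hy t => ?_⟩, hi, fun t => h.sat t.1 t.2⟩
  · rw [Trace.ext_ofFun h.nonneg f ht]
    exact (h.hasDeriv x hx t ht).congr_of_mem
      (fun s hs => by rw [Trace.ext_ofFun h.nonneg f hs]) ht
  · exact (h.contDeriv x hx).congr fun s hs => by
      dsimp only
      rw [Trace.ext_ofFun h.nonneg f hs]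
  · rw [hi]
    exact h.const y hy t.1 t.2

/-- Prefixes of traces are traces; this is why a box, which inspects only final states, controls all
times. -/
theorem DapCurve.restrict {X : List Var} {F : RA} {σ : State} {T t : ℝ} {f : ℝ → State}
    (h : DapCurve X F σ T f) (ht : t ∈ Set.Icc 0 T) : DapCurve X F σ t f := by
  have hs : Set.Icc 0 t ⊆ Set.Icc 0 T := Set.Icc_subset_Icc_right ht.2
  exact ⟨ht.1, fun x hx s hs' => (h.hasDeriv x hx s (hs hs')).mono hs,
    fun x hx => (h.contDeriv x hx).mono hs, fun y hy s hs' => h.const y hy s (hs hs'), h.init,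
    fun s hs' => h.sat s (hs hs')⟩

theorem DapCurve.withSat {X : List Var} {F G : RA} {σ : State} {T : ℝ} {f : ℝ → State}
    (h : DapCurve X F σ T f) (hG : ∀ t ∈ Set.Icc 0 T, G.sat (f t)) : DapCurve X G σ T f :=
  { h with sat := hG }

theorem DapCurve.hasDeriv_const {X : List Var} {F : RA} {σ : State} {T : ℝ} {f : ℝ → State}
    (h : DapCurve X F σ T f) {y : Var} (hy : y ∉ both X) {t : ℝ} (ht : t ∈ Set.Icc 0 T) :
    HasDerivWithinAt (fun s => f s y) 0 (Set.Icc 0 T) t :=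
  (hasDerivWithinAt_const t _ (σ y)).congr_of_mem (fun s hs => h.const y hy s hs) ht

theorem mem_both {X : List Var} {v : Var} : v ∈ both X ↔ v ∈ X ∨ ∃ x ∈ X, x.prime = v := by
  simp [both, primes]

theorem both_append (X Z : List Var) : both (X ++ Z) = both X ∪ both Z := by
  ext v
  simp only [mem_both, Finset.mem_union, List.mem_append]
  grind

theorem DapCurve.continuousOn {X : List Var} {F : RA} {σ : State} {T : ℝ} {f : ℝ → State}
    (h : DapCurve X F σ T f) : ContinuousOn f (Set.Icc 0 T) := by
  refine continuousOn_pi.2 fun v => ?_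
  by_cases hv : v ∈ both X
  · rcases mem_both.1 hv with hx | ⟨x, hx, rfl⟩
    · exact fun t ht => (h.hasDeriv v hx t ht).continuousWithinAt
    · exact h.contDeriv x hx
  · exact fun t ht => (h.hasDeriv_const hv ht).continuousWithinAt

/-- Keep the components of a curve in `X, X'` and replace all others by those of `τ`. -/
def rebase (X : List Var) (τ : State) (f : ℝ → State) : ℝ → State :=
  fun t v => if v ∈ both X then f t v else τ v

/-- Regularity concerns only `X` and `X'`, so it survives dropping variables and changing the frozen
ones. The constraint may read those, hence has to be supplied anew. -/
theorem DapCurve.rebase {X Y : List Var} {F G : RA} {σ τ : State} {T : ℝ} {f : ℝ → State}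
    (h : DapCurve Y F σ T f) (hXY : ∀ x ∈ X, x ∈ Y) (hτ : ∀ v ∈ both X, σ v = τ v)
    (hG : ∀ t ∈ Set.Icc 0 T, G.sat (rebase X τ f t)) : DapCurve X G τ T (rebase X τ f) where
  nonneg := h.nonneg
  hasDeriv x hx t ht := by
    have h1 : x ∈ both X := mem_both.2 (.inl hx)
    have h2 : x.prime ∈ both X := mem_both.2 (.inr ⟨x, hx, rfl⟩)
    simpa [DAL.rebase, h1, h2] using h.hasDeriv x (hXY x hx) t ht
  contDeriv x hx := by
    have h2 : x.prime ∈ both X := mem_both.2 (.inr ⟨x, hx, rfl⟩)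
    simpa [DAL.rebase, h2] using h.contDeriv x (hXY x hx)
  const y hy t _ := by simp [DAL.rebase, hy]
  init y hy := by simp [DAL.rebase, hy, h.zero, hτ y hy]
  sat := hG

/-- The box of a differential-algebraic program speaks about all times of all traces. -/
theorem sat_box_dap {X : List Var} {F : RA} {P : Form} {σ : State} :
    (Form.box (.dap X F) P).sat σ ↔
      ∀ T f, DapCurve X F σ T f → ∀ t ∈ Set.Icc 0 T, P.sat (f t) := by
  constructor
  · intro h T f hf t ht
    exact h _ (hf.restrict ht).ofFun_mem
  · intro h φ hφ
    rw [φ.final_eq_ext]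
    exact h _ _ (DapCurve.of_mem hφ) _ ⟨φ.dur_nonneg, le_rfl⟩

theorem sat_ref_dap {X Y Z : List Var} {F G : RA} {σ : State} :
    (Form.ref X (.dap Y F) (.dap Z G)).sat σ ↔
      ∀ T f, DapCurve Y F σ T f → ∃ g, DapCurve Z G σ T g ∧
        ∀ t ∈ Set.Icc 0 T, ∀ v ∈ both X, f t v = g t v := by
  constructor
  · intro h T f hf
    obtain ⟨ψ, hψ, hc⟩ := h _ hf.ofFun_mem
    obtain ⟨hd, hc⟩ := (coincide_iff _ _ _).1 hc
    have hd' : T = ψ.dur := hd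
    subst hd'
    refine ⟨ψ.ext, DapCurve.of_mem hψ, fun t ht v hv => ?_⟩
    rw [← hc t ht v hv, Trace.ext_ofFun hf.nonneg f ht]
  · intro h φ hφ
    have hf := DapCurve.of_mem hφ
    obtain ⟨g, hg, hc⟩ := h _ _ hf
    refine ⟨_, hg.ofFun_mem, (coincide_iff _ _ _).2 ⟨rfl, fun t ht v hv => ?_⟩⟩
    rw [Trace.ext_ofFun hg.nonneg g ht, hc t ht v hv]

/-! ### Coincidence and bound effect -/

/-- Traces of a program depend only on the free variables of the program. -/
theorem Prog.sem_coincidence (α : Prog) {V : Finset Var} (hV : α.fv ⊆ V) {σ τ : State}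
    (h : ∀ v ∈ V, σ v = τ v) {φ : Trace} (hφ : φ ∈ α.sem σ) :
    ∃ ψ ∈ α.sem τ, φ.AgreeOn V ψ ∧ ∀ v ∈ V ∪ α.mbv, φ.final v = ψ.final v := by
  induction α generalizing V σ τ φ with
  | assign x e =>
    obtain rfl : φ = _ := hφ
    have he : e.eval σ = e.eval τ := e.eval_congr fun v hv => h v (hV hv)
    have key : ∀ v ∈ V ∪ {x},
        Function.update σ x (e.eval σ) v = Function.update τ x (e.eval τ) v := by
      intro v hv
      by_cases hvx : v = x
      · subst hvx; simp [he]
      · simpa [hvx] using h v (by simpa [hvx] using hv)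
    exact ⟨_, rfl, Trace.agreeOn_point fun v hv => key v (Finset.mem_union_left _ hv), key⟩
  | test Q =>
    obtain ⟨rfl, hQ⟩ := hφ
    refine ⟨_, ⟨rfl, (RA.sat_congr fun v hv => h v (hV hv)).1 hQ⟩, Trace.agreeOn_point h,
      fun v hv => h v (by simpa [Prog.mbv] using hv)⟩
  | dap X F =>
    simp only [Prog.fv] at hV
    have hf := DapCurve.of_mem hφ
    have key : ∀ t ∈ Set.Icc 0 φ.dur, ∀ v ∈ V, φ.ext t v = rebase X τ φ.ext t v := by
      intro t ht v hv
      by_cases hX : v ∈ both X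
      · simp [rebase, hX]
      · simp [rebase, hX, hf.const v hX t ht, h v hv]
    have hg : DapCurve X F τ φ.dur (rebase X τ φ.ext) :=
      hf.rebase (fun _ hx => hx) (fun v hv => h v (hV (Finset.mem_union_left _ hv)))
        fun t ht => (RA.sat_congr fun v hv =>
          key t ht v (hV (Finset.mem_union_right _ hv))).1 (hf.sat t ht)
    have hag : φ.AgreeOn V (Trace.ofFun φ.dur hg.nonneg (rebase X τ φ.ext)) :=
      ⟨rfl, fun t ht v hv => by rw [Trace.ext_ofFun hg.nonneg _ ht, key t ht v hv]⟩
    refine ⟨_, hg.ofFun_mem, hag, fun v hv => hag.final ?_⟩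
    rcases Finset.mem_union.1 hv with hv | hv
    · exact hv
    · exact hV (Finset.mem_union_left _ hv)
  | choice α β ihα ihβ =>
    obtain ⟨hVα, hVβ⟩ := Finset.union_subset_iff.1 hV
    simp only [Prog.mbv, Finset.mem_union, Finset.mem_inter] at ihα ihβ ⊢
    rcases hφ with hφ | hφ
    · obtain ⟨ψ, hψ, hag, hfin⟩ := ihα hVα h hφ
      exact ⟨ψ, .inl hψ, hag, fun v hv => hfin v (hv.imp_right And.left)⟩
    · obtain ⟨ψ, hψ, hag, hfin⟩ := ihβ hVβ h hφ
      exact ⟨ψ, .inr hψ, hag, fun v hv => hfin v (hv.imp_right And.right)⟩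
  | seq α β ihα ihβ =>
    obtain ⟨hVα, hVβ⟩ := Finset.union_subset_iff.1 hV
    obtain ⟨φ₁, h₁, φ₂, h₂, rfl⟩ := hφ
    obtain ⟨ψ₁, hψ₁, hag₁, hfin₁⟩ := ihα hVα h h₁
    -- After `α` the states also agree on what `α` surely binds. This accounts for the removal of
    -- `α.mbv` in the free variables of `α ; β` and for the second half of the conclusion.
    obtain ⟨ψ₂, hψ₂, hag₂, hfin₂⟩ := ihβ (V := V ∪ α.mbv)
      (fun v hv => by
        by_cases hm : v ∈ α.mbv
        · exact Finset.mem_union_right _ hm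
        · exact Finset.mem_union_left _ (hVβ (Finset.mem_sdiff.2 ⟨hv, hm⟩))) hfin₁ h₂
    refine ⟨_, ⟨ψ₁, hψ₁, ψ₂, hψ₂, rfl⟩,
      hag₁.concat (hag₂.mono Finset.subset_union_left), fun v hv => ?_⟩
    rw [Trace.final_concat, Trace.final_concat]
    exact hfin₂ v (by simpa [Prog.mbv, Finset.union_assoc] using hv)
  | loop α ih =>
    obtain ⟨n, hn⟩ := Set.mem_iUnion.1 hφ
    -- A loop may run zero times and surely binds nothing, so agreement on `V` is the whole
    -- invariant.
    have key : ∀ n, ∀ σ τ : State, (∀ v ∈ V, σ v = τ v) → ∀ φ ∈ iterSem α.sem n σ,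
        ∃ ψ ∈ iterSem α.sem n τ, φ.AgreeOn V ψ := by
      intro n
      induction n with
      | zero =>
        rintro σ τ h φ rfl
        exact ⟨_, rfl, Trace.agreeOn_point h⟩
      | succ n ihn =>
        rintro σ τ h φ ⟨φ₁, h₁, φ₂, h₂, rfl⟩
        obtain ⟨ψ₁, hψ₁, hag₁, -⟩ := ih hV h h₁
        obtain ⟨ψ₂, hψ₂, hag₂⟩ := ihn _ _ (fun v hv => hag₁.final hv) φ₂ h₂
        exact ⟨_, ⟨ψ₁, hψ₁, ψ₂, hψ₂, rfl⟩, hag₁.concat hag₂⟩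
    obtain ⟨ψ, hψ, hag⟩ := key n σ τ h φ hn
    refine ⟨ψ, Set.mem_iUnion.2 ⟨n, hψ⟩, hag, fun v hv => hag.final (by simpa [Prog.mbv] using hv)⟩

/-- The truth of a formula depends only on its free variables. -/
theorem Form.sat_of_agree {P : Form} {σ τ : State} (h : ∀ v ∈ P.fv, σ v = τ v)
    (hP : P.sat σ) : P.sat τ := by
  induction P generalizing σ τ with
  | le e g =>
    simp only [Form.fv, Finset.mem_union] at h
    simpa only [Form.sat, e.eval_congr fun v hv => h v (.inl hv),
      g.eval_congr fun v hv => h v (.inr hv)] using hP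
  | neg P ih => exact fun hτ => hP (ih (fun v hv => (h v hv).symm) hτ)
  | and P Q ihP ihQ =>
    simp only [Form.fv, Finset.mem_union] at h
    exact ⟨ihP (fun v hv => h v (.inl hv)) hP.1, ihQ (fun v hv => h v (.inr hv)) hP.2⟩
  | all x P ih =>
    intro r
    refine ih (fun v hv => ?_) (hP r)
    by_cases hvx : v = x
    · subst hvx; simp
    · simpa [hvx] using h v (by simp [Form.fv, hvx, hv])
  | box α P ih =>
    intro φ hφ
    obtain ⟨ψ, hψ, -, hfin⟩ := α.sem_coincidence (V := (Form.box α P).fv)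
      Finset.subset_union_left (fun v hv => (h v hv).symm) hφ
    refine ih (fun v hv => (hfin v ?_).symm) (hP ψ hψ)
    by_cases hm : v ∈ α.mbv
    · exact Finset.mem_union_right _ hm
    · exact Finset.mem_union_left _ (Finset.mem_union_right _ (Finset.mem_sdiff.2 ⟨hv, hm⟩))
  | ref X α β =>
    intro φ hφ
    -- The trace is carried from `τ` to `σ`, refined there, and the refining trace is carried back.
    obtain ⟨φ', hφ', hag, -⟩ := α.sem_coincidence (V := (Form.ref X α β).fv)
      (by intro v hv; simp [Form.fv, hv]) (fun v hv => (h v hv).symm) hφ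
    obtain ⟨ψ', hψ', hc⟩ := hP φ' hφ'
    obtain ⟨ψ, hψ, hag', -⟩ := β.sem_coincidence (V := (Form.ref X α β).fv)
      (by intro v hv; simp [Form.fv, hv]) h hψ'
    have hX : both X ⊆ (Form.ref X α β).fv := Finset.subset_union_right
    exact ⟨ψ, hψ, (coincide_iff _ _ _).2
      ((hag.mono hX).trans (((coincide_iff _ _ _).1 hc).trans (hag'.mono hX)))⟩

theorem Form.sat_congr {P : Form} {σ τ : State} (h : ∀ v ∈ P.fv, σ v = τ v) :
    P.sat σ ↔ P.sat τ :=
  ⟨Form.sat_of_agree h, Form.sat_of_agree fun v hv => (h v hv).symm⟩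

/-- A program changes at most its bound variables. -/
theorem Prog.final_eq_of_notMem_bv (α : Prog) {v : Var} (hv : v ∉ α.bv) {σ : State} {φ : Trace}
    (hφ : φ ∈ α.sem σ) : φ.final v = σ v := by
  induction α generalizing σ φ with
  | assign x e =>
    obtain rfl : φ = _ := hφ
    exact Function.update_of_ne (by simpa [Prog.bv] using hv) _ _
  | test Q =>
    obtain ⟨rfl, -⟩ := hφ
    rfl
  | dap X F =>
    rw [φ.final_eq_ext]
    exact (DapCurve.of_mem hφ).const v hv _ ⟨φ.dur_nonneg, le_rfl⟩
  | choice α β ihα ihβ =>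
    simp only [Prog.bv, Finset.mem_union, not_or] at hv
    exact hφ.elim (ihα hv.1) (ihβ hv.2)
  | seq α β ihα ihβ =>
    simp only [Prog.bv, Finset.mem_union, not_or] at hv
    obtain ⟨φ₁, h₁, φ₂, h₂, rfl⟩ := hφ
    rw [Trace.final_concat, ihβ hv.2 h₂, ihα hv.1 h₁]
  | loop α ih =>
    obtain ⟨n, hn⟩ := Set.mem_iUnion.1 hφ
    have key : ∀ n, ∀ σ : State, ∀ φ ∈ iterSem α.sem n σ, φ.final v = σ v := by
      intro n
      induction n with
      | zero =>
        rintro σ φ rfl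
        rfl
      | succ n ihn =>
        rintro σ φ ⟨φ₁, h₁, φ₂, h₂, rfl⟩
        rw [Trace.final_concat, ihn _ _ h₂, ih hv h₁]
    exact key n σ φ hn

end

end DAL

namespace DAL

noncomputable section

open Filter Topology

/-! ### Linear differential equations -/

/-- Coordinatewise truncation of a vector to the cube `[-R, R]ⁿ`. -/
def clamp {ι : Type*} (R : ℝ) (x : ι → ℝ) : ι → ℝ := fun i => max (-R) (min R (x i))

theorem clamp_eq_self {ι : Type*} [Fintype ι] {R : ℝ} {x : ι → ℝ} (hx : ‖x‖ ≤ R) :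
    clamp R x = x := by
  funext i
  have := abs_le.1 ((norm_le_pi_norm x i).trans hx)
  simp [clamp, this.1, this.2]

theorem norm_clamp_le {ι : Type*} [Fintype ι] {R : ℝ} (hR : 0 ≤ R) (x : ι → ℝ) :
    ‖clamp R x‖ ≤ R := by
  refine (pi_norm_le_iff_of_nonneg hR).2 fun i => abs_le.2 ⟨le_max_left _ _, ?_⟩
  exact max_le (by linarith) (min_le_left _ _)

theorem lipschitzWith_clamp {ι : Type*} [Fintype ι] (R : ℝ) :
    LipschitzWith 1 (clamp R : (ι → ℝ) → ι → ℝ) := by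
  refine LipschitzWith.of_dist_le_mul fun x y => (dist_pi_le_iff (by positivity)).2 fun i => ?_
  have h : LipschitzWith 1 fun x : ι → ℝ => x i := LipschitzWith.eval i
  exact ((h.const_min R).const_max (-R)).dist_le_mul x y

/-- With this the truncated vector field obeys the same linear growth bound as the original one. -/
theorem norm_clamp_le_norm {ι : Type*} [Fintype ι] {R : ℝ} (hR : 0 ≤ R) (x : ι → ℝ) :
    ‖clamp R x‖ ≤ ‖x‖ := by
  have h0 : clamp R (0 : ι → ℝ) = 0 := clamp_eq_self (by simpa using hR)
  simpa [h0] using (lipschitzWith_clamp R).norm_sub_le x 0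

/-- A vector field that is Lipschitz in space, uniformly in time, has solutions on the whole
time interval. -/
theorem exists_solution_of_lipschitz {ι : Type*} [Fintype ι] {T : ℝ} (hT : 0 ≤ T) {K : NNReal}
    {v : ℝ → (ι → ℝ) → ι → ℝ} (hlip : ∀ t ∈ Set.Icc 0 T, LipschitzWith K (v t))
    (hcont : ∀ x, ContinuousOn (fun t => v t x) (Set.Icc 0 T)) (x₀ : ι → ℝ) :
    ∃ y : ℝ → ι → ℝ, y 0 = x₀ ∧
      ∀ t ∈ Set.Icc 0 T, HasDerivWithinAt y (v t (y t)) (Set.Icc 0 T) t := by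
  obtain ⟨B, hB⟩ := isCompact_Icc.exists_bound_of_continuousOn (hcont 0)
  have hB0 : 0 ≤ B := (norm_nonneg _).trans (hB 0 ⟨le_rfl, hT⟩)
  have hgrow : ∀ t ∈ Set.Icc 0 T, ∀ x, ‖v t x‖ ≤ K * ‖x‖ + B := fun t ht x => by
    have h1 := (hlip t ht).norm_sub_le x 0
    have h2 := norm_le_norm_sub_add (v t x) (v t 0)
    rw [sub_zero] at h1
    linarith [hB t ht]
  have hmono := gronwallBound_mono (norm_nonneg x₀) hB0 K.coe_nonneg
  -- `R` is the Gronwall bound at the final time, valid for every solution with growth `K‖x‖ + B`.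
  set R : ℝ := gronwallBound ‖x₀‖ K B T with hRdef
  have hR : 0 ≤ R := by
    have := hmono hT
    rw [gronwallBound_x0] at this
    exact (norm_nonneg _).trans this
  have hL : 0 ≤ K * R + B := by positivity
  -- The truncated field is bounded by `K R + B`, so a ball of radius `(K R + B) T` holds the
  -- solution up to time `T`.
  have hPL : IsPicardLindelof (fun t x => v t (clamp R x)) (tmin := 0) (tmax := T)
      ⟨0, le_rfl, hT⟩ x₀ ⟨(K * R + B) * T, by positivity⟩ 0 ⟨K * R + B, hL⟩ K :=
    { lipschitzOnWith := fun t ht => by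
        have := (hlip t ht).comp (lipschitzWith_clamp R)
        rw [mul_one] at this
        exact this.lipschitzOnWith
      continuousOn := fun x _ => hcont _
      norm_le := fun t ht x _ => (hgrow t ht _).trans (by
        have := mul_le_mul_of_nonneg_left (norm_clamp_le hR x) K.coe_nonneg
        change _ ≤ (K : ℝ) * R + B
        linarith)
      mul_max_le := by
        simp only [sub_zero, sub_self, max_eq_left hT, NNReal.coe_zero]
        exact le_rfl }
  obtain ⟨y, hy0, hy⟩ := hPL.exists_eq_forall_mem_Icc_hasDerivWithinAt₀
  -- The solution never leaves the cube, so the truncation is inactive along it.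
  have hbound : ∀ t ∈ Set.Icc 0 T, ‖y t‖ ≤ R := fun t ht => by
    refine (norm_le_gronwallBound_of_norm_deriv_right_le (δ := ‖x₀‖) (K := K) (ε := B)
      (fun t ht => (hy t ht).continuousWithinAt)
      (fun t ht => (hy t (Set.Ico_subset_Icc_self ht)).mono_of_mem_nhdsWithin
        (Icc_mem_nhdsGE_of_mem ht)) (by rw [show y 0 = x₀ from hy0])
      (fun t ht => ?_) t ht).trans (hmono (by simpa using ht.2))
    refine (hgrow t (Set.Ico_subset_Icc_self ht) _).trans ?_
    have := mul_le_mul_of_nonneg_left (norm_clamp_le_norm hR (y t)) K.coe_nonneg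
    linarith
  refine ⟨y, hy0, fun t ht => ?_⟩
  have := hy t ht
  rwa [clamp_eq_self (hbound t ht)] at this

/-- Linear differential equations with continuous coefficients have global solutions. -/
theorem exists_solution_of_linear {m : ℕ} {T : ℝ} (hT : 0 ≤ T)
    {M : ℝ → Matrix (Fin m) (Fin m) ℝ} (hM : ContinuousOn M (Set.Icc 0 T))
    {d : ℝ → Fin m → ℝ} (hd : ContinuousOn d (Set.Icc 0 T)) (x₀ : Fin m → ℝ) :
    ∃ y : ℝ → Fin m → ℝ, y 0 = x₀ ∧
      ∀ t ∈ Set.Icc 0 T, HasDerivWithinAt y ((M t).mulVec (y t) + d t) (Set.Icc 0 T) t := by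
  -- The operator norms of `Φ (M t)` are bounded on the compact interval and give a uniform
  -- Lipschitz constant.
  let Φ : Matrix (Fin m) (Fin m) ℝ →ₗ[ℝ] ((Fin m → ℝ) →L[ℝ] (Fin m → ℝ)) :=
    (LinearMap.toContinuousLinearMap.toLinearMap).comp (Matrix.toLin').toLinearMap
  have hΦ : ∀ A x, Φ A x = A.mulVec x := fun A x => by simp [Φ]
  have hΦc : ContinuousOn (fun t => Φ (M t)) (Set.Icc 0 T) :=
    (LinearMap.continuous_of_finiteDimensional Φ).comp_continuousOn hM
  obtain ⟨K, hK⟩ := isCompact_Icc.exists_bound_of_continuousOn hΦc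
  refine exists_solution_of_lipschitz (K := K.toNNReal) hT
    (v := fun t x => (M t).mulVec x + d t) (fun t ht => ?_) (fun x => ?_) x₀
  · have h : LipschitzWith K.toNNReal (Φ (M t)) :=
      (Φ (M t)).lipschitz.weaken (NNReal.le_toNNReal_of_coe_le (hK t ht))
    refine LipschitzWith.of_dist_le_mul fun x y => ?_
    rw [dist_add_right, ← hΦ, ← hΦ]
    exact h.dist_le_mul x y
  · refine ContinuousOn.add ?_ hd
    exact (Continuous.matrix_mulVec continuous_id continuous_const).comp_continuousOn hM

/-! ### Implicitly defined curves -/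

theorem continuousAt_matrix_inv_real {n : ℕ} {A : Matrix (Fin n) (Fin n) ℝ} (h : A.det ≠ 0) :
    ContinuousAt Inv.inv A :=
  continuousAt_matrix_inv A (NormedRing.inverse_continuousAt (Units.mk0 _ h))

theorem continuousOn_matrix_inv {n : ℕ} {A : ℝ → Matrix (Fin n) (Fin n) ℝ} {s : Set ℝ}
    (hA : ContinuousOn A s) (hdet : ∀ t ∈ s, (A t).det ≠ 0) :
    ContinuousOn (fun t => (A t)⁻¹) s := fun t ht =>
  (continuousAt_matrix_inv_real (hdet t ht)).tendsto.comp (hA t ht)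

/-- If a continuous curve solves the equations `e = 0` and the Jacobian of `e` in the variables `W`
is invertible, then the `W`-components are differentiable as soon as all others are. -/
theorem hasDerivWithinAt_of_implicit {n : ℕ} {W : Fin n → Var} {e : Fin n → Term}
    (hop : ∀ i, (e i).OpFree) {f : ℝ → State} {s : Set ℝ} {t : ℝ} {d : Var → ℝ} {S : Finset Var}
    (hS : ∀ i, (e i).fv ⊆ S) (ht : t ∈ s) (hf : ContinuousWithinAt f s t)
    (hd : ∀ v ∈ S \ Finset.univ.image W, HasDerivWithinAt (fun r => f r v) (d v) s t)
    (he : ∀ r ∈ s, ∀ i, (e i).eval (f r) = 0)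
    (hdet : (evalMat (jac W e) (f t)).det ≠ 0) (j : Fin n) :
    HasDerivWithinAt (fun r => f r (W j))
      (((evalMat (jac W e) (f t))⁻¹).mulVec
        (fun i => -∑ v ∈ S \ Finset.univ.image W, d v * ((e i).pd v).eval (f t)) j) s t := by
  set U := S \ Finset.univ.image W with hU
  -- A repeated variable would give two equal columns of the Jacobian.
  have hW : Function.Injective W := fun i k hik => by
    by_contra hne
    exact hdet (Matrix.det_zero_of_column_eq hne fun l => by simp [evalMat, jac, hik])
  have hUW : ∀ i, (e i).fv ⊆ U ∪ Finset.univ.image W := fun i v hv => by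
    by_cases h : v ∈ Finset.univ.image W
    · exact Finset.mem_union_right _ h
    · exact Finset.mem_union_left _ (Finset.mem_sdiff.2 ⟨hS i hv, h⟩)
  have hdisj : Disjoint U (Finset.univ.image W) := Finset.sdiff_disjoint
  let Q : ℝ → Matrix (Fin n) (Fin n) ℝ := fun r =>
    Matrix.of fun i k => (e i).quot (W k) (f t) (f r)
  let b : ℝ → Fin n → ℝ := fun r i =>
    -∑ v ∈ U, slope (fun r => f r v) t r * (e i).quot v (f t) (f r)
  have hQt : Q t = evalMat (jac W e) (f t) := by
    ext i k
    simp [Q, evalMat, jac, Term.quot_self (hop i)]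
  -- Dividing `0 = e(f r) - e(f t)` by `r - t` gives an exact linear system for the slopes of the
  -- `W`-components. At `r = t` it reads `0 = 0`, as the inverse of 0 is 0.
  have hsolve : ∀ r ∈ s, (Q r).mulVec (fun k => slope (fun r => f r (W k)) t r) = b r := by
    intro r hr
    funext i
    have h := Term.eval_sub_eval (hop i) (f t) (f r) (hUW i)
    rw [he r hr i, he t ht i, sub_zero, Finset.sum_union hdisj,
      Finset.sum_image fun _ _ _ _ h => hW h] at h
    have h2 := congrArg (fun z => (r - t)⁻¹ * z) h
    simp only [mul_zero, mul_add, Finset.mul_sum] at h2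
    simp only [b, Matrix.mulVec, dotProduct, Q, Matrix.of_apply, slope_def_module, smul_eq_mul]
    rw [eq_neg_iff_add_eq_zero, add_comm, h2]
    congr 1
    · exact Finset.sum_congr rfl fun v _ => by ring
    · exact Finset.sum_congr rfl fun v _ => by ring
  have hle : 𝓝[s \ {t}] t ≤ 𝓝[s] t := nhdsWithin_mono _ Set.sdiff_subset
  have hquot : ∀ i v, Tendsto (fun r => (e i).quot v (f t) (f r)) (𝓝[s \ {t}] t)
      (𝓝 (((e i).pd v).eval (f t))) := fun i v => by
    rw [← Term.quot_self (hop i)]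
    exact (((e i).continuous_quot v (f t)).continuousAt.tendsto.comp hf).mono_left hle
  have hQ : Tendsto Q (𝓝[s \ {t}] t) (𝓝 (evalMat (jac W e) (f t))) :=
    tendsto_pi_nhds.2 fun i => tendsto_pi_nhds.2 fun k => hquot i (W k)
  have hb : Tendsto b (𝓝[s \ {t}] t)
      (𝓝 fun i => -∑ v ∈ U, d v * ((e i).pd v).eval (f t)) :=
    tendsto_pi_nhds.2 fun i => (tendsto_finsetSum _ fun v hv =>
      (hasDerivWithinAt_iff_tendsto_slope.1 (hd v hv)).mul (hquot i v)).neg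
  have hQinv : Tendsto (fun r => (Q r)⁻¹) (𝓝[s \ {t}] t) (𝓝 (evalMat (jac W e) (f t))⁻¹) :=
    (continuousAt_matrix_inv_real hdet).tendsto.comp hQ
  have hlim : Tendsto (fun r => ((Q r)⁻¹).mulVec (b r)) (𝓝[s \ {t}] t)
      (𝓝 (((evalMat (jac W e) (f t))⁻¹).mulVec
        fun i => -∑ v ∈ U, d v * ((e i).pd v).eval (f t))) :=
    ((Continuous.matrix_mulVec continuous_fst continuous_snd).tendsto _).comp
      (hQinv.prodMk_nhds hb)
  -- The quotient matrix tends to the invertible Jacobian, so the system is solvable near `t` and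
  -- its solution converges.
  have hne : ∀ᶠ r in 𝓝[s \ {t}] t, (Q r).det ≠ 0 :=
    ((Continuous.matrix_det continuous_id).continuousAt.tendsto.comp hQ).eventually_ne hdet
  rw [hasDerivWithinAt_iff_tendsto_slope]
  refine (tendsto_pi_nhds.1 hlim j).congr' ?_
  filter_upwards [hne, self_mem_nhdsWithin] with r hr hrs
  rw [← hsolve r hrs.1, Matrix.mulVec_mulVec, Matrix.nonsing_inv_mul _ (isUnit_iff_ne_zero.2 hr),
    Matrix.one_mulVec]

end

end DAL

namespace DAL

noncomputable section

/-! ### Differential invariants -/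

/-- Along a trace, the differential term `(e)'` is the time derivative of `e`. -/
theorem DapCurve.hasDeriv_eval {X P : List Var} {F : RA} {σ : State} {T : ℝ} {f : ℝ → State}
    (h : DapCurve X F σ T f) {e : Term} (he : TermIn X P e) (hP : ∀ p ∈ P, σ p.prime = 0)
    {t : ℝ} (ht : t ∈ Set.Icc 0 T) :
    HasDerivWithinAt (fun s => e.eval (f s)) ((Term.diff e).eval (f t)) (Set.Icc 0 T) t := by
  rw [e.eval_diff _ subset_rfl]
  refine e.hasDerivWithinAt_eval subset_rfl fun v hv => ?_
  by_cases hX : v ∈ X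
  · exact h.hasDeriv v hX t ht
  -- A parameter and its differential variable are both constant along the trace, and the latter is
  -- initially 0.
  · have hvP : v ∈ P := by simpa [hX] using he.1 hv
    have h1 : v ∉ both X := Finset.disjoint_left.1 he.2 (mem_both.2 (.inl hvP))
    have h2 : v.prime ∉ both X :=
      Finset.disjoint_left.1 he.2 (mem_both.2 (.inr ⟨v, hvP, rfl⟩))
    rw [h.const _ h2 t ht, hP v hvP]
    exact h.hasDeriv_const h1 ht

/-- The constraint makes `e` nonincreasing in time. Comparing with the initial value serves the
strict and the non-strict axiom alike. -/
theorem DapCurve.eval_le_eval_zero {X P : List Var} {σ : State} {T : ℝ} {f : ℝ → State} {e : Term}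
    (h : DapCurve X (.le (.diff e) (.const 0)) σ T f) (he : TermIn X P e)
    (hP : ∀ p ∈ P, σ p.prime = 0) {t : ℝ} (ht : t ∈ Set.Icc 0 T) : e.eval (f t) ≤ e.eval σ := by
  have hanti : AntitoneOn (fun s => e.eval (f s)) (Set.Icc 0 T) :=
    antitoneOn_of_hasDerivWithinAt_nonpos (convex_Icc 0 T)
      (fun s hs => (h.hasDeriv_eval he hP hs).continuousWithinAt)
      (fun s hs => (h.hasDeriv_eval he hP (interior_subset hs)).mono interior_subset)
      (fun s hs => by simpa [RA.sat, Term.eval] using h.sat s (interior_subset hs))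
  have := hanti ⟨le_rfl, h.nonneg⟩ ht ht.1
  simpa [h.zero] using this

/-- On an interval of positive length `e` vanishes identically, and so does its one-sided
derivative. A point trace carries no such information; there the initial condition is needed. -/
theorem DapCurve.eval_diff_eq_zero {X P : List Var} {σ : State} {T : ℝ} {f : ℝ → State} {e : Term}
    (h : DapCurve X (RA.eq e (.const 0)) σ T f) (he : TermIn X P e)
    (hP : ∀ p ∈ P, σ p.prime = 0) (h0 : (Term.diff e).eval σ = 0) {t : ℝ}
    (ht : t ∈ Set.Icc 0 T) : (Term.diff e).eval (f t) = 0 := by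
  rcases h.nonneg.eq_or_lt with hT | hT
  · obtain rfl : t = 0 := le_antisymm (hT ▸ ht.2) ht.1
    rwa [h.zero]
  · have hc : HasDerivWithinAt (fun s => e.eval (f s)) 0 (Set.Icc 0 T) t :=
      (hasDerivWithinAt_const t _ (0 : ℝ)).congr_of_mem
        (fun s hs => by simpa [Term.eval] using h.sat s hs) ht
    exact (uniqueDiffOn_Icc hT t ht).eq_deriv _ (h.hasDeriv_eval he hP ht) hc

/-! ### Ghost variables -/

/-- Assign the values `a` to the variables `Z` and `b` to the variables `Z'`. -/
def overlay {m : ℕ} (Z : Fin m → Var) (a b : Fin m → ℝ) (τ : State) : State := fun v =>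
  open Classical in
  if h : ∃ i, Z i = v then a h.choose
  else if h : ∃ i, (Z i).prime = v then b h.choose
  else τ v

theorem Var.prime_injective : Function.Injective Var.prime := fun x y h => by
  cases x
  cases y
  simpa [Var.prime] using h

theorem mem_both_ofFn {m : ℕ} {Z : Fin m → Var} {v : Var} :
    v ∈ both (List.ofFn Z) ↔ (∃ i, Z i = v) ∨ ∃ i, (Z i).prime = v := by
  simp [mem_both, List.mem_ofFn]

theorem Ghost.injective {m : ℕ} {Z : Fin m → Var} {X : List Var} (h : Ghost (List.ofFn Z) X) :
    Function.Injective Z :=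
  List.nodup_ofFn.1 (List.nodup_append.1 h.1).1

theorem Ghost.ne_prime {m : ℕ} {Z : Fin m → Var} {X : List Var} (h : Ghost (List.ofFn Z) X)
    (i j : Fin m) : Z i ≠ (Z j).prime :=
  (List.nodup_append.1 h.1).2.2 _ (by simp [List.mem_ofFn]) _ (by simp [primes, List.mem_ofFn])

theorem overlay_var {m : ℕ} {Z : Fin m → Var} {X : List Var} (hZ : Ghost (List.ofFn Z) X)
    (a b : Fin m → ℝ) (τ : State) (i : Fin m) : overlay Z a b τ (Z i) = a i := by
  have h : ∃ j, Z j = Z i := ⟨i, rfl⟩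
  rw [overlay, dif_pos h, hZ.injective h.choose_spec]

theorem overlay_prime {m : ℕ} {Z : Fin m → Var} {X : List Var} (hZ : Ghost (List.ofFn Z) X)
    (a b : Fin m → ℝ) (τ : State) (i : Fin m) : overlay Z a b τ (Z i).prime = b i := by
  have h : ∃ j, (Z j).prime = (Z i).prime := ⟨i, rfl⟩
  rw [overlay, dif_neg (fun ⟨j, hj⟩ => hZ.ne_prime j i hj), dif_pos h,
    hZ.injective (Var.prime_injective h.choose_spec)]

theorem overlay_of_notMem {m : ℕ} {Z : Fin m → Var} (a b : Fin m → ℝ) (τ : State) {v : Var}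
    (hv : v ∉ both (List.ofFn Z)) : overlay Z a b τ v = τ v := by
  rw [mem_both_ofFn, not_or] at hv
  rw [overlay, dif_neg hv.1, dif_neg hv.2]

/-- Extend a trace by ghost variables with prescribed values. -/
theorem DapCurve.overlay {m : ℕ} {Z : Fin m → Var} {X : List Var} {F R : RA} {ρ : State} {T : ℝ}
    {f : ℝ → State} (h : DapCurve X F ρ T f) (hZ : Ghost (List.ofFn Z) X)
    (hF : Disjoint (both (List.ofFn Z)) F.fv) {y w : ℝ → Fin m → ℝ}
    (hy : ∀ t ∈ Set.Icc 0 T, ∀ i, HasDerivWithinAt (fun s => y s i) (w t i) (Set.Icc 0 T) t)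
    (hw : ∀ i, ContinuousOn (fun s => w s i) (Set.Icc 0 T))
    (hy0 : ∀ i, y 0 i = ρ (Z i)) (hw0 : ∀ i, w 0 i = ρ (Z i).prime)
    (hR : ∀ t ∈ Set.Icc 0 T, R.sat (DAL.overlay Z (y t) (w t) (f t))) :
    DapCurve (X ++ List.ofFn Z) (.and F R) ρ T fun t => DAL.overlay Z (y t) (w t) (f t) where
  nonneg := h.nonneg
  hasDeriv x hx t ht := by
    rcases List.mem_append.1 hx with hx | hx
    · have h1 : x ∉ both (List.ofFn Z) :=
        Finset.disjoint_right.1 hZ.2 (mem_both.2 (.inl hx))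
      have h2 : x.prime ∉ both (List.ofFn Z) :=
        Finset.disjoint_right.1 hZ.2 (mem_both.2 (.inr ⟨x, hx, rfl⟩))
      simpa only [overlay_of_notMem _ _ _ h1, overlay_of_notMem _ _ _ h2] using h.hasDeriv x hx t ht
    · obtain ⟨i, rfl⟩ := List.mem_ofFn.1 hx
      simpa only [overlay_var hZ, overlay_prime hZ] using hy t ht i
  contDeriv x hx := by
    rcases List.mem_append.1 hx with hx | hx
    · have h2 : x.prime ∉ both (List.ofFn Z) :=
        Finset.disjoint_right.1 hZ.2 (mem_both.2 (.inr ⟨x, hx, rfl⟩))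
      simpa only [overlay_of_notMem _ _ _ h2] using h.contDeriv x hx
    · obtain ⟨i, rfl⟩ := List.mem_ofFn.1 hx
      simpa only [overlay_prime hZ] using hw i
  const v hv t ht := by
    rw [both_append, Finset.mem_union, not_or] at hv
    rw [overlay_of_notMem _ _ _ hv.2, h.const v hv.1 t ht]
  init v _ := by
    by_cases hv : v ∈ both (List.ofFn Z)
    · rcases mem_both_ofFn.1 hv with ⟨i, rfl⟩ | ⟨i, rfl⟩
      · rw [overlay_var hZ, hy0]
      · rw [overlay_prime hZ, hw0]
    · rw [overlay_of_notMem _ _ _ hv, h.zero]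
  sat t ht := ⟨(RA.sat_congr fun _ hv =>
    overlay_of_notMem _ _ _ (Finset.disjoint_right.1 hF hv)).2 (h.sat t ht), hR t ht⟩

/-- Values of ghost variables do not matter for a trace. -/
theorem DapCurve.rebase_ghost {X Z : List Var} {F : RA} {σ ρ : State} {T : ℝ} {f : ℝ → State}
    (h : DapCurve X F ρ T f) (hZX : Disjoint (both Z) (both X)) (hF : Disjoint (both Z) F.fv)
    (hρ : ∀ v ∉ both Z, ρ v = σ v) :
    DapCurve X F σ T (DAL.rebase X σ f) ∧
      ∀ t ∈ Set.Icc 0 T, ∀ v ∉ both Z, DAL.rebase X σ f t v = f t v := by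
  have key : ∀ t ∈ Set.Icc 0 T, ∀ v ∉ both Z, DAL.rebase X σ f t v = f t v := by
    intro t ht v hv
    by_cases hX : v ∈ both X
    · simp [DAL.rebase, hX]
    · simp [DAL.rebase, hX, h.const v hX t ht, hρ v hv]
  exact ⟨h.rebase (fun _ hx => hx) (fun v hv => hρ v (Finset.disjoint_right.1 hZX hv))
    fun t ht => (RA.sat_congr fun v hv => key t ht v (Finset.disjoint_right.1 hF hv)).2
      (h.sat t ht), key⟩

/-- Rate of change of the variables along a trace on which `e = 0` with invertible Jacobian
in the variables `X'`. -/
def implicitRate {n : ℕ} (X : Fin n → Var) (e : Fin n → Term) (τ : State) : Var → ℝ := fun v =>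
  open Classical in
  -- A variable in both `X` and `X'` counts as implicitly defined.
  if h : ∃ j, (X j).prime = v then
    ((evalMat (jac (fun j => (X j).prime) e) τ)⁻¹).mulVec
      (fun i => -∑ v ∈ (Finset.univ.biUnion fun i => (e i).fv) \
          Finset.univ.image fun j => (X j).prime,
        (if v ∈ List.ofFn X then τ v.prime else 0) * ((e i).pd v).eval τ) h.choose
  else if v ∈ List.ofFn X then τ v.prime else 0

/-- The `X'`-components are a priori only continuous; the equations `e = 0` make them
differentiable. -/
theorem DapCurve.hasDeriv_implicitRate {n : ℕ} {X : Fin n → Var} {e : Fin n → Term} {F : RA}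
    {σ : State} {T : ℝ} {f : ℝ → State} (h : DapCurve (List.ofFn X) F σ T f)
    (hop : ∀ i, (e i).OpFree) (he : ∀ t ∈ Set.Icc 0 T, ∀ i, (e i).eval (f t) = 0)
    (hdet : ∀ t ∈ Set.Icc 0 T, (evalMat (jac (fun j => (X j).prime) e) (f t)).det ≠ 0)
    (v : Var) {t : ℝ} (ht : t ∈ Set.Icc 0 T) :
    HasDerivWithinAt (fun s => f s v) (implicitRate X e (f t) v) (Set.Icc 0 T) t := by
  have hexpl : ∀ v, (¬ ∃ j, (X j).prime = v) → HasDerivWithinAt (fun s => f s v)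
      (if v ∈ List.ofFn X then f t v.prime else 0) (Set.Icc 0 T) t := by
    intro v hv
    split_ifs with hX
    · exact h.hasDeriv v hX t ht
    · refine h.hasDeriv_const (fun hb => ?_) ht
      rcases mem_both_ofFn.1 hb with ⟨j, hj⟩ | hj
      · exact hX (List.mem_ofFn.2 ⟨j, hj⟩)
      · exact hv hj
  rw [implicitRate]
  split_ifs with hv
  · have := hasDerivWithinAt_of_implicit (W := fun j => (X j).prime) hop (d := fun v =>
      if v ∈ List.ofFn X then f t v.prime else 0) (S := Finset.univ.biUnion fun i => (e i).fv)
      (fun i => Finset.subset_biUnion_of_mem (fun i => (e i).fv) (Finset.mem_univ i))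
      ht (h.continuousOn t ht) (fun v hv => hexpl v (by simpa using (Finset.mem_sdiff.1 hv).2))
      he (hdet t ht) hv.choose
    rwa [hv.choose_spec] at this
  · simpa [*] using hexpl v hv
  · simpa [*] using hexpl v hv

/-- Needed because regularity also asks for continuity of the ghost derivatives `Z'`. -/
theorem DapCurve.continuousOn_implicitRate {n : ℕ} {X : Fin n → Var} {e : Fin n → Term} {F : RA}
    {σ : State} {T : ℝ} {f : ℝ → State} (h : DapCurve (List.ofFn X) F σ T f)
    (hdet : ∀ t ∈ Set.Icc 0 T, (evalMat (jac (fun j => (X j).prime) e) (f t)).det ≠ 0)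
    (v : Var) : ContinuousOn (fun t => implicitRate X e (f t) v) (Set.Icc 0 T) := by
  have hexpl : ∀ v, ContinuousOn (fun t => if v ∈ List.ofFn X then f t v.prime else 0)
      (Set.Icc 0 T) := by
    intro v
    split_ifs with hX
    · exact h.contDeriv v hX
    · exact continuousOn_const
  by_cases hv : ∃ j, (X j).prime = v
  · simp only [implicitRate, hv, dite_true]
    have hJ : ContinuousOn (fun t => evalMat (jac (fun j => (X j).prime) e) (f t))
        (Set.Icc 0 T) := (continuous_evalMat _).comp_continuousOn h.continuousOn
    have hinv : ContinuousOn (fun t => (evalMat (jac (fun j => (X j).prime) e) (f t))⁻¹)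
        (Set.Icc 0 T) := continuousOn_matrix_inv hJ hdet
    have hb : ContinuousOn (fun t => fun i =>
        -∑ v ∈ (Finset.univ.biUnion fun i => (e i).fv) \ Finset.univ.image fun j => (X j).prime,
          (if v ∈ List.ofFn X then f t v.prime else 0) * ((e i).pd v).eval (f t))
        (Set.Icc 0 T) :=
      continuousOn_pi.2 fun i => (continuousOn_finsetSum _ fun v _ => (hexpl v).mul
        (((e i).pd v).continuous_eval.comp_continuousOn h.continuousOn)).neg
    exact (continuous_apply _).comp_continuousOn
      ((Continuous.matrix_mulVec continuous_fst continuous_snd).comp_continuousOn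
        (hinv.prodMk hb))
  · simpa only [implicitRate, hv, dite_false] using hexpl v

end

end DAL

namespace DAL

noncomputable section

/-! ### Validity of the axioms -/

theorem valid_jacobian {m n : ℕ} (X : Fin n → Var) (P : List Var) (e : Fin m → Term)
    (hX : Function.Injective X) (hop : ∀ i, (e i).OpFree)
    (he : ∀ i, TermIn (List.ofFn X) P (e i)) :
    (withParams P
      (RA.vecEq (fun i => .diff (e i)) (mulVec (jac X e) (dvars X))).toForm).Valid := by
  intro σ
  rw [sat_withParams, RA.sat_toForm, RA.sat_vecEq]
  intro hP i
  rw [eval_mulVec, (e i).eval_diff σ (S := Finset.univ.image X ∪ P.toFinset) (fun v hv => by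
      simpa [List.mem_ofFn] using (he i).1 hv), ← Finset.sum_subset Finset.subset_union_left,
    Finset.sum_image fun _ _ _ _ h => hX h]
  · refine Finset.sum_congr rfl fun j _ => ?_
    rw [jac, Term.eval_pd (hop i), mul_comm]
    rfl
  -- The remaining summands belong to parameters, whose differential variables are 0.
  · intro v hv hn
    have hvP : v ∈ P := by
      rcases Finset.mem_union.1 hv with hv | hv
      · exact absurd hv hn
      · simpa using hv
    rw [hP v hvP, zero_mul]

/-- Each free variable of `P` is either compared by the refinement or left unchanged by both
programs, so both final states agree on `P`. -/
theorem valid_refBox (X : List Var) (α β : Prog) (P : Form)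
    (h : ∀ v ∈ P.fv, v ∈ X ∨ v ∉ α.bv ∪ β.bv) :
    ((Form.ref X α β).imp ((Form.box β P).imp (.box α P))).Valid := by
  intro σ
  simp only [Form.sat_imp]
  intro href hbox φ hφ
  obtain ⟨ψ, hψ, hc⟩ := href φ hφ
  have hag := (coincide_iff _ _ _).1 hc
  refine Form.sat_of_agree (fun v hv => ?_) (hbox ψ hψ)
  rcases h v hv with hX | hb
  · exact (hag.final (mem_both.2 (.inl hX))).symm
  · rw [Finset.mem_union, not_or] at hb
    rw [α.final_eq_of_notMem_bv hb.1 hφ, β.final_eq_of_notMem_bv hb.2 hψ]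

theorem valid_refTrans (X : List Var) (α β γ : Prog) :
    ((Form.ref X α β).imp ((Form.ref X β γ).imp (.ref X α γ))).Valid := by
  intro σ
  simp only [Form.sat_imp]
  intro h₁ h₂ φ hφ
  obtain ⟨ψ, hψ, hc⟩ := h₁ φ hφ
  obtain ⟨χ, hχ, hc'⟩ := h₂ ψ hψ
  exact ⟨χ, hχ, (coincide_iff _ _ _).2
    (((coincide_iff _ _ _).1 hc).trans ((coincide_iff _ _ _).1 hc'))⟩

theorem valid_dW (X : List Var) (F : RA) : (Form.box (.dap X F) F.toForm).Valid := fun _ =>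
  sat_box_dap.2 fun _ _ h t ht => (F.sat_toForm _).2 (h.sat t ht)

theorem valid_dIle (X P : List Var) (e : Term) (he : TermIn X P e) :
    (withParams P ((RA.le e (.const 0)).toForm.imp
      (.box (.dap X (.le (.diff e) (.const 0))) (RA.le e (.const 0)).toForm))).Valid := by
  intro σ
  rw [sat_withParams, Form.sat_imp, sat_box_dap]
  intro hP h0 T f hf t ht
  exact (hf.eval_le_eval_zero he hP ht).trans h0

theorem valid_dIlt (X P : List Var) (e : Term) (he : TermIn X P e) :
    (withParams P ((RA.lt e (.const 0)).toForm.imp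
      (.box (.dap X (.le (.diff e) (.const 0))) (RA.lt e (.const 0)).toForm))).Valid := by
  intro σ
  rw [sat_withParams, Form.sat_imp, sat_box_dap]
  simp only [RA.sat_toForm, RA.sat_lt]
  intro hP h0 T f hf t ht
  exact (hf.eval_le_eval_zero he hP ht).trans_lt h0

theorem valid_dHC (X P : List Var) (e : Term) (he : TermIn X P e) :
    (withParams P ((RA.eq (.diff e) (.const 0)).toForm.imp
      (.box (.dap X (RA.eq e (.const 0))) (RA.eq (.diff e) (.const 0)).toForm))).Valid := by
  intro σ
  rw [sat_withParams, Form.sat_imp, sat_box_dap]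
  simp only [RA.sat_toForm, RA.sat_eq, Term.eval.eq_1, Rat.cast_zero]
  intro hP h0 T f hf t ht
  exact hf.eval_diff_eq_zero he hP h0 ht

theorem valid_aG {n m : ℕ} (X : Fin n → Var) (Z : Fin m → Var) (F : RA) (e : Fin n → Term)
    (g : Fin m → Term) (hop : ∀ i, (e i).OpFree)
    (hZ : Ghost (List.ofFn Z) (List.ofFn X))
    (hF : Disjoint (both (List.ofFn Z)) F.fv)
    (hg : ∀ i, Disjoint (both (List.ofFn Z)) (g i).fv) :
    ((Form.box (.dap (List.ofFn X) F)
          (RA.and (RA.vecEq e fun _ => .const 0)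
            (RA.ne (mdet (jac (fun j => (X j).prime) e)) (.const 0))).toForm).imp
        (Form.exs (List.ofFn Z) (Form.exs (primes (List.ofFn Z))
          (.ref (List.ofFn X) (.dap (List.ofFn X) F)
            (.dap (List.ofFn X ++ List.ofFn Z) (.and F (RA.vecEq (vars Z) g))))))).Valid := by
  intro σ
  simp only [Form.sat_imp, sat_box_dap, RA.sat_toForm, RA.sat_and, RA.sat_vecEq, RA.sat_ne,
    eval_mdet, Term.eval.eq_1, Rat.cast_zero, Form.sat_exs]
  intro hbox
  let y : State → Fin m → ℝ := fun τ i => (g i).eval τ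
  let w : State → Fin m → ℝ := fun τ i =>
    ∑ v ∈ (g i).fv, implicitRate X e τ v * (g i).partialAt v τ
  -- The two quantifier blocks set first `Z` to `g`, then `Z'` to the rate of `g`. Both values
  -- depend on `σ` alone, not on the trace chosen later.
  refine ⟨overlay Z (y σ) (fun i => σ (Z i).prime) σ, fun v hv => ?_,
    overlay Z (y σ) (w σ) σ, fun v hv => ?_, sat_ref_dap.2 fun T f hf => ?_⟩
  · by_cases hb : v ∈ both (List.ofFn Z)
    · rcases mem_both_ofFn.1 hb with ⟨i, rfl⟩ | ⟨i, rfl⟩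
      · exact absurd (List.mem_ofFn.2 ⟨i, rfl⟩) hv
      · rw [overlay_prime hZ]
    · rw [overlay_of_notMem _ _ _ hb]
  · by_cases hb : v ∈ both (List.ofFn Z)
    · rcases mem_both_ofFn.1 hb with ⟨i, rfl⟩ | ⟨i, rfl⟩
      · rw [overlay_var hZ, overlay_var hZ]
      · exact absurd (List.mem_map_of_mem (List.mem_ofFn.2 ⟨i, rfl⟩)) hv
    · rw [overlay_of_notMem _ _ _ hb, overlay_of_notMem _ _ _ hb]
  -- The box hypothesis speaks about `σ`, the trace starts in the state with ghost values; resetting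
  -- the ghosts connects the two.
  obtain ⟨hk, hkf⟩ := hf.rebase_ghost (σ := σ) hZ.2 hF fun v hv => overlay_of_notMem _ _ _ hv
  set k := rebase (List.ofFn X) σ f
  have he := fun t ht => (hbox T k hk t ht).1
  have hdet := fun t ht => (hbox T k hk t ht).2
  have key := hf.overlay (R := RA.vecEq (vars Z) g) hZ hF (y := fun t => y (k t))
    (w := fun t => w (k t))
    (fun t ht i => (g i).hasDerivWithinAt_eval (d := implicitRate X e (k t)) subset_rfl
      fun v _ => hk.hasDeriv_implicitRate hop he hdet v ht)
    (fun i => continuousOn_finsetSum _ fun v _ => (hk.continuousOn_implicitRate hdet v).mul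
      (((g i).continuous_partialAt v).comp_continuousOn hk.continuousOn))
    (fun i => by rw [overlay_var hZ, hk.zero]) (fun i => by rw [overlay_prime hZ, hk.zero])
    (fun t ht => by
      rw [RA.sat_vecEq]
      intro i
      rw [vars, Term.eval, overlay_var hZ]
      refine (g i).eval_congr fun v hv => ?_
      have hvZ := Finset.disjoint_right.1 (hg i) hv
      rw [overlay_of_notMem _ _ _ hvZ, hkf t ht v hvZ])
  exact ⟨_, key, fun t _ v hv =>
    (overlay_of_notMem _ _ _ (Finset.disjoint_right.1 hZ.2 hv)).symm⟩

theorem valid_dG {m : ℕ} (X : List Var) (Z : Fin m → Var) (F : RA)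
    (A B : Matrix (Fin m) (Fin m) Term) (c : Fin m → Term)
    (hZ : Ghost (List.ofFn Z) X)
    (hF : Disjoint (both (List.ofFn Z)) F.fv)
    (hA : ∀ i j, Disjoint (both (List.ofFn Z)) (A i j).fv)
    (hB : ∀ i j, Disjoint (both (List.ofFn Z)) (B i j).fv)
    (hc : ∀ i, Disjoint (both (List.ofFn Z)) (c i).fv) :
    ((Form.box (.dap X F) (RA.ne (mdet A) (.const 0)).toForm).imp
        (Form.alls (List.ofFn Z) (Form.exs (primes (List.ofFn Z))
          (.ref X (.dap X F)
            (.dap (X ++ List.ofFn Z) (.and F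
              (RA.vecEq (mulVec A (dvars Z))
                fun i => .add (mulVec B (vars Z) i) (c i)))))))).Valid := by
  intro σ
  simp only [Form.sat_imp, sat_box_dap, RA.sat_toForm, RA.sat_ne,
    eval_mdet, Term.eval.eq_1, Rat.cast_zero, Form.sat_exs, Form.sat_alls]
  intro hbox ρ hρ
  let cv : State → Fin m → ℝ := fun τ i => (c i).eval τ
  let M : State → Matrix (Fin m) (Fin m) ℝ := fun τ => (evalMat A τ)⁻¹ * evalMat B τ
  let d : State → Fin m → ℝ := fun τ => ((evalMat A τ)⁻¹).mulVec (cv τ)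
  let z : Fin m → ℝ := fun i => ρ (Z i)
  -- The initial `Z'` is forced: it is `A⁻¹(BZ + c)` at the initial state.
  refine ⟨overlay Z z ((M σ).mulVec z + d σ) ρ, fun v hv => ?_, sat_ref_dap.2 fun T f hf => ?_⟩
  · by_cases hb : v ∈ both (List.ofFn Z)
    · rcases mem_both_ofFn.1 hb with ⟨i, rfl⟩ | ⟨i, rfl⟩
      · rw [overlay_var hZ]
      · exact absurd (List.mem_map_of_mem (List.mem_ofFn.2 ⟨i, rfl⟩)) hv
    · rw [overlay_of_notMem _ _ _ hb]
  obtain ⟨hk, hkf⟩ := hf.rebase_ghost (σ := σ) hZ.2 hF fun v hv => by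
    rw [overlay_of_notMem _ _ _ hv, hρ v fun h => hv (mem_both.2 (.inl h))]
  set k := rebase X σ f
  have hdet := hbox T k hk
  have hAc : ContinuousOn (fun t => evalMat A (k t)) (Set.Icc 0 T) :=
    (continuous_evalMat A).comp_continuousOn hk.continuousOn
  have hBc : ContinuousOn (fun t => evalMat B (k t)) (Set.Icc 0 T) :=
    (continuous_evalMat B).comp_continuousOn hk.continuousOn
  have hcc : ContinuousOn (fun t => cv (k t)) (Set.Icc 0 T) :=
    continuousOn_pi.2 fun i => (c i).continuous_eval.comp_continuousOn hk.continuousOn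
  have hAi : ContinuousOn (fun t => (evalMat A (k t))⁻¹) (Set.Icc 0 T) :=
    continuousOn_matrix_inv hAc hdet
  have hMc : ContinuousOn (fun t => M (k t)) (Set.Icc 0 T) := hAi.mul hBc
  have hdc : ContinuousOn (fun t => d (k t)) (Set.Icc 0 T) :=
    (Continuous.matrix_mulVec continuous_fst continuous_snd).comp_continuousOn (hAi.prodMk hcc)
  obtain ⟨y, hy0, hy⟩ := exists_solution_of_linear hf.nonneg hMc hdc z
  have hyc : ContinuousOn y (Set.Icc 0 T) := fun t ht => (hy t ht).continuousWithinAt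
  have hwc : ContinuousOn (fun t => (M (k t)).mulVec (y t) + d (k t)) (Set.Icc 0 T) :=
    ((Continuous.matrix_mulVec continuous_fst continuous_snd).comp_continuousOn
      (hMc.prodMk hyc)).add hdc
  have key := hf.overlay (R := RA.vecEq (mulVec A (dvars Z))
      fun i => .add (mulVec B (vars Z) i) (c i)) hZ hF (y := y)
    (w := fun t => (M (k t)).mulVec (y t) + d (k t))
    (fun t ht i => hasDerivWithinAt_pi.1 (hy t ht) i)
    (fun i => continuousOn_pi.1 hwc i)
    (fun i => by rw [overlay_var hZ, hy0]) (fun i => by rw [overlay_prime hZ, hk.zero, hy0])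
    (fun t ht => by
      rw [RA.sat_vecEq]
      intro i
      set w := (M (k t)).mulVec (y t) + d (k t) with hw
      have hagree : ∀ e : Term, Disjoint (both (List.ofFn Z)) e.fv →
          e.eval (overlay Z (y t) w (f t)) = e.eval (k t) := fun e he =>
        e.eval_congr fun v hv => by
          have hvZ := Finset.disjoint_right.1 he hv
          rw [overlay_of_notMem _ _ _ hvZ, hkf t ht v hvZ]
      -- Multiplying the solved equation by `A` recovers the constraint.
      have hAw : (evalMat A (k t)).mulVec w = (evalMat B (k t)).mulVec (y t) + cv (k t) := by
        have hu := isUnit_iff_ne_zero.2 (hdet t ht)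
        simp only [hw, M, d, Matrix.mulVec_add, Matrix.mulVec_mulVec, ← Matrix.mul_assoc,
          Matrix.mul_nonsing_inv _ hu, Matrix.one_mul, Matrix.one_mulVec]
      have := congrFun hAw i
      simp only [Term.eval, eval_mulVec, dvars, vars, overlay_var hZ, overlay_prime hZ,
        hagree _ (hA _ _), hagree _ (hB _ _), hagree _ (hc _)]
      exact this)
  exact ⟨_, key, fun t _ v hv =>
    (overlay_of_notMem _ _ _ (Finset.disjoint_right.1 hZ.2 hv)).symm⟩

/-! ### Cut, refinement, monotonicity and projection. -/

theorem valid_dC (X : List Var) (F R : RA) :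
    ((Form.box (.dap X F) R.toForm).imp (.ref X (.dap X F) (.dap X R))).Valid := by
  intro σ
  simp only [Form.sat_imp, sat_box_dap, sat_ref_dap, RA.sat_toForm]
  exact fun h T f hf => ⟨f, hf.withSat (h T f hf), fun _ _ _ _ => rfl⟩

theorem valid_dCand (X : List Var) (F R : RA) :
    ((Form.box (.dap X F) R.toForm).imp (.ref X (.dap X F) (.dap X (.and F R)))).Valid := by
  intro σ
  simp only [Form.sat_imp, sat_box_dap, sat_ref_dap, RA.sat_toForm]
  exact fun h T f hf =>
    ⟨f, hf.withSat fun t ht => ⟨hf.sat t ht, h T f hf t ht⟩, fun _ _ _ _ => rfl⟩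

theorem valid_dR (X Z : List Var) (F R : RA) (hF : Disjoint (both Z) F.fv) :
    (Form.alls Z (Form.alls (primes Z)
      (.ref X (.dap (X ++ Z) (.and R F)) (.dap X F)))).Valid := by
  intro σ
  simp only [Form.sat_alls, sat_ref_dap]
  intro _ _ ρ _ T f hf
  -- The variables outside `X` and `X'` are frozen at their initial values, which `F` cannot notice.
  refine ⟨rebase X ρ f, hf.rebase (fun x hx => List.mem_append_left _ hx) (fun _ _ => rfl)
    fun t ht => (RA.sat_congr fun v hv => ?_).1 (hf.sat t ht).2, fun t _ v hv => ?_⟩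
  · by_cases hX : v ∈ both X
    · simp [rebase, hX]
    · have hZ : v ∉ both Z := Finset.disjoint_right.1 hF hv
      simp [rebase, hX, hf.const v (by simp [both_append, hX, hZ]) t ht]
  · simp [rebase, hv]

/-- Refinement between differential-algebraic programs that change the same variables is
inclusion. -/
theorem sat_ref_dap_self {X : List Var} {F G : RA} {σ : State} :
    (Form.ref X (.dap X F) (.dap X G)).sat σ ↔
      ∀ T f, DapCurve X F σ T f → ∀ t ∈ Set.Icc 0 T, G.sat (f t) := by
  rw [sat_ref_dap]
  constructor
  · intro h T f hf t ht
    obtain ⟨g, hg, hc⟩ := h T f hf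
    have : f t = g t := by
      funext v
      by_cases hv : v ∈ both X
      · exact hc t ht v hv
      · rw [hf.const v hv t ht, hg.const v hv t ht]
    exact this ▸ hg.sat t ht
  · exact fun h T f hf => ⟨f, hf.withSat (h T f hf), fun _ _ _ _ => rfl⟩

theorem valid_dM (X : List Var) (F G R : RA) :
    ((Form.ref X (.dap X F) (.dap X G)).imp
      (.ref X (.dap X (.and F R)) (.dap X (.and G R)))).Valid := by
  intro σ
  simp only [Form.sat_imp, sat_ref_dap_self]
  exact fun h T f hf t ht =>
    ⟨h T f (hf.withSat fun s hs => (hf.sat s hs).1) t ht, (hf.sat t ht).2⟩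

theorem RA.sat_exs_of_agree {Y : List Var} {F : RA} {σ τ : State} (h : ∀ v ∉ both Y, σ v = τ v)
    (hF : F.sat σ) : (RA.exs (primes Y) (RA.exs Y F)).sat τ := by
  rw [RA.sat_exs]
  -- Intermediate state between the two quantifier blocks: `Y'` is already changed, `Y` not yet.
  refine ⟨fun v => if v ∈ primes Y then σ v else τ v, fun v hv => by simp [hv],
    (RA.sat_exs _ _ _).2 ⟨σ, fun v hv => ?_, hF⟩⟩
  by_cases hp : v ∈ primes Y
  · simp [hp]
  · simpa [hp] using h v (by simp [both, hv, hp])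

/-- The box premises say that `F` and `G` do not depend on `Y` along the relevant traces. Freezing
`Y` in a trace of `F` keeps `F`, the refinement yields `G` there, and restoring `Y` keeps `G`. -/
theorem valid_dP (X Y : List Var) (F G : RA) :
    ((Form.and (.box (.dap X (RA.exs (primes Y) (RA.exs Y F))) F.toForm)
          (.box (.dap (X ++ Y) (RA.exs (primes Y) (RA.exs Y G))) G.toForm)).imp
        ((Form.ref X (.dap X F) (.dap X G)).imp
          (.ref (X ++ Y) (.dap (X ++ Y) F) (.dap (X ++ Y) G)))).Valid := by
  intro σ
  simp only [Form.sat_imp, sat_ref_dap_self]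
  rintro ⟨hFbox, hGbox⟩ href T f hf
  simp only [sat_box_dap, RA.sat_toForm] at hFbox hGbox
  have hagree : ∀ t ∈ Set.Icc 0 T, ∀ v ∉ both Y, f t v = rebase X σ f t v := by
    intro t ht v hv
    by_cases hX : v ∈ both X
    · simp [rebase, hX]
    · simp [rebase, hX, hf.const v (by simp [both_append, hX, hv]) t ht]
  have hk : DapCurve X (RA.exs (primes Y) (RA.exs Y F)) σ T (rebase X σ f) :=
    hf.rebase (fun x hx => List.mem_append_left _ hx) (fun _ _ => rfl)
      fun t ht => RA.sat_exs_of_agree (hagree t ht) (hf.sat t ht)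
  have hG := href T _ (hk.withSat (hFbox T _ hk))
  exact hGbox T f (hf.withSat fun t ht =>
    RA.sat_exs_of_agree (fun v hv => (hagree t ht v hv).symm) (hG t ht))

/-! ### Axioms of dynamic logic. -/

theorem sat_box_seq (α β : Prog) (P : Form) (σ : State) :
    (Form.box (.seq α β) P).sat σ ↔ (Form.box α (.box β P)).sat σ := by
  constructor
  · intro h φ hφ ψ hψ
    rw [← φ.final_concat ψ]
    exact h _ ⟨φ, hφ, ψ, hψ, rfl⟩
  · rintro h _ ⟨φ, hφ, ψ, hψ, rfl⟩
    rw [Trace.final_concat]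
    exact h φ hφ ψ hψ

/-- A loop reaches exactly the states related by the reflexive transitive closure of its body. -/
theorem sat_box_loop (α : Prog) (P : Form) (σ : State) :
    (Form.box (.loop α) P).sat σ ↔
      ∀ τ, Relation.ReflTransGen (fun σ τ => ∃ φ ∈ α.sem σ, φ.final = τ) σ τ → P.sat τ := by
  constructor
  · intro h τ hτ
    suffices H : ∃ n, ∃ φ ∈ iterSem α.sem n σ, φ.final = τ by
      obtain ⟨n, φ, hφ, rfl⟩ := H
      exact h φ (Set.mem_iUnion.2 ⟨n, hφ⟩)
    clear h
    induction hτ using Relation.ReflTransGen.head_induction_on with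
    | refl => exact ⟨0, _, rfl, rfl⟩
    | head hs _ ih =>
      obtain ⟨φ, hφ, rfl⟩ := hs
      obtain ⟨n, ψ, hψ, hfin⟩ := ih
      exact ⟨n + 1, _, ⟨φ, hφ, ψ, hψ, rfl⟩, by rw [Trace.final_concat, hfin]⟩
  · intro h φ hφ
    obtain ⟨n, hn⟩ := Set.mem_iUnion.1 hφ
    refine h _ ?_
    clear h hφ
    induction n generalizing σ φ with
    | zero =>
      obtain rfl : φ = _ := hn
      exact .refl
    | succ n ih =>
      obtain ⟨φ, hφ, ψ, hψ, rfl⟩ := hn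
      rw [Trace.final_concat]
      exact .head ⟨φ, hφ, rfl⟩ (ih _ _ hψ)

/-- Splits off the first iteration. -/
theorem valid_boxLoop (α : Prog) (P : Form) :
    ((Form.box (.loop α) P).iff (.and P (.box α (.box (.loop α) P)))).Valid := by
  intro σ
  rw [Form.sat_iff]
  constructor
  · intro h
    rw [sat_box_loop] at h
    exact ⟨h σ .refl, fun φ hφ => (sat_box_loop _ _ _).2 fun τ hτ => h τ (.head ⟨φ, hφ, rfl⟩ hτ)⟩
  · rintro ⟨hP, h⟩
    rw [sat_box_loop]
    intro τ hτ
    rcases hτ.cases_head with rfl | ⟨_, ⟨φ, hφ, rfl⟩, hτ⟩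
    · exact hP
    · exact (sat_box_loop _ _ _).1 (h φ hφ) τ hτ

/-- Induction on reachability, splitting off the last iteration. -/
theorem valid_boxInd (α : Prog) (P : Form) :
    ((Form.box (.loop α) P).iff (.and P (.box (.loop α) (P.imp (.box α P))))).Valid := by
  intro σ
  rw [Form.sat_iff]
  constructor
  · intro h
    rw [sat_box_loop] at h
    refine ⟨h σ .refl, (sat_box_loop _ _ _).2 fun τ hτ => ?_⟩
    rw [Form.sat_imp]
    exact fun _ φ hφ => h _ (hτ.tail ⟨φ, hφ, rfl⟩)
  · rintro ⟨hP, h⟩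
    rw [sat_box_loop] at h ⊢
    intro τ hτ
    induction hτ with
    | refl => exact hP
    | tail hs hst ih =>
      obtain ⟨φ, hφ, rfl⟩ := hst
      exact (Form.sat_imp _ _ _).1 (h _ hs) ih φ hφ

theorem valid_boxAssign (x : Var) (e : Term) (P : Form) (h : x ∉ e.fv) :
    ((Form.box (.assign x e) P).iff (.all x ((RA.eq (.var x) e).toForm.imp P))).Valid := by
  intro σ
  have he : ∀ r, e.eval (Function.update σ x r) = e.eval σ := fun r =>
    e.eval_congr fun v hv => Function.update_of_ne (by rintro rfl; exact h hv) _ _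
  simp only [Form.sat_iff, Form.sat, Form.sat_imp, RA.sat_toForm, RA.sat_eq, he, Term.eval.eq_2,
    Function.update_self]
  constructor
  · rintro hP r rfl
    exact hP _ rfl
  · rintro hP _ rfl
    exact hP _ rfl

/-- All axioms are valid. -/
theorem Ax.valid {P : Form} (h : Ax P) : P.Valid := by
  induction h with
  | diffVar x =>
    intro σ
    -- In polynomial form the four differential term axioms are the defining properties of a
    -- derivation.
    rw [RA.sat_toForm, RA.sat_eq, Term.eval_eq_poly, Term.eval_eq_poly]
    simp [Term.poly]
  | diffConst c =>
    intro σ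
    rw [RA.sat_toForm, RA.sat_eq, Term.eval_eq_poly, Term.eval_eq_poly]
    simp [Term.poly]
  | diffAdd e g =>
    intro σ
    rw [RA.sat_toForm, RA.sat_eq, Term.eval_eq_poly, Term.eval_eq_poly]
    simp [Term.poly]
  | diffMul e g =>
    intro σ
    rw [RA.sat_toForm, RA.sat_eq, Term.eval_eq_poly, Term.eval_eq_poly]
    simp only [Term.poly, Derivation.leibniz, smul_eq_mul, map_add, map_mul]
    ring
  | jacobian X P e hX hop he => exact valid_jacobian X P e hX hop he
  | refBox X α β P h => exact valid_refBox X α β P h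
  | refTrans X α β γ => exact valid_refTrans X α β γ
  | dW X F => exact valid_dW X F
  | dIle X P e he => exact valid_dIle X P e he
  | dIlt X P e he => exact valid_dIlt X P e he
  | dHC X P e he => exact valid_dHC X P e he
  | aG X Z F e g hop hZ hF hg => exact valid_aG X Z F e g hop hZ hF hg
  | dG X Z F A B c hZ hF hA hB hc => exact valid_dG X Z F A B c hZ hF hA hB hc
  | dC X F R => exact valid_dC X F R
  | dCand X F R => exact valid_dCand X F R
  | dR X Z F R hF => exact valid_dR X Z F R hF
  | dM X F G R => exact valid_dM X F G R
  | dP X Y F G => exact valid_dP X Y F G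
  | boxK α P Q =>
    intro σ
    simp only [Form.sat_imp, Form.sat]
    exact fun h₁ h₂ φ hφ => h₁ φ hφ (h₂ φ hφ)
  | boxV α P h =>
    intro σ
    rw [Form.sat_imp]
    exact fun hP φ hφ => Form.sat_of_agree (fun v hv =>
      (α.final_eq_of_notMem_bv (Finset.disjoint_left.1 h hv) hφ).symm) hP
  | boxAssign x e P h => exact valid_boxAssign x e P h
  | boxTest Q P =>
    intro σ
    rw [Form.sat_iff, Form.sat_imp, RA.sat_toForm]
    constructor
    · exact fun h hQ => h _ ⟨rfl, hQ⟩
    · rintro h _ ⟨rfl, hQ⟩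
      exact h hQ
  | boxChoice α β P =>
    intro σ
    rw [Form.sat_iff]
    exact ⟨fun h => ⟨fun φ hφ => h φ (.inl hφ), fun φ hφ => h φ (.inr hφ)⟩,
      fun h φ hφ => hφ.elim (h.1 φ) (h.2 φ)⟩
  | boxSeq α β P =>
    intro σ
    rw [Form.sat_iff]
    exact sat_box_seq α β P σ
  | boxLoop α P => exact valid_boxLoop α P
  | boxInd α P => exact valid_boxInd α P
  | allElim x P =>
    intro σ
    rw [Form.sat_imp]
    intro h
    simpa using h (σ x)
  | allInst x e P =>
    intro σ
    rw [Form.sat_imp]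
    rintro h _ rfl
    exact h _
  | eqRefl e =>
    intro σ
    rw [RA.sat_toForm, RA.sat_eq]
  | leCongr e e₁ g g₁ =>
    intro σ
    simp only [Form.sat_imp, RA.sat_toForm, RA.sat_eq, Form.sat]
    intro h₁ h₂ h
    rwa [← h₁, ← h₂]
  | addCongr e e₁ g g₁ =>
    intro σ
    simp only [Form.sat_imp, RA.sat_toForm, RA.sat_eq, Term.eval]
    intro h₁ h₂
    rw [h₁, h₂]
  | mulCongr e e₁ g g₁ =>
    intro σ
    simp only [Form.sat_imp, RA.sat_toForm, RA.sat_eq, Term.eval]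
    intro h₁ h₂
    rw [h₁, h₂]

/-! ### Soundness of the rules -/

theorem Rule.sound {ps : List Sequent} {s : Sequent} (h : Rule ps s)
    (hps : ∀ p ∈ ps, p.Valid) : s.Valid := by
  cases h with
  | ax P h Γ Δ => exact fun σ _ => ⟨P, by simp, h.valid σ⟩
  | real F hop h Γ Δ => exact fun σ _ => ⟨F.toForm, by simp, (F.sat_toForm σ).2 (h σ)⟩
  | gen α P Γ Δ =>
    -- The premise has no context, so it applies in the final state, where `Γ` may fail.
    refine fun σ _ => ⟨_, List.mem_cons_self, fun φ _ => ?_⟩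
    simpa using hps ⟨[], [P]⟩ (by simp) φ.final (by simp)
  | id P Γ Δ => exact fun σ h => ⟨P, by simp, h P (by simp)⟩
  | weaken Γ Δ Γ₁ Δ₁ hΓ hΔ =>
    intro σ h
    obtain ⟨P, hP, hs⟩ := hps _ List.mem_cons_self σ fun P hP => h P (hΓ hP)
    exact ⟨P, hΔ hP, hs⟩
  | cut P Γ Δ =>
    have h₁ := hps ⟨Γ, P :: Δ⟩ (by simp)
    have h₂ := hps ⟨P :: Γ, Δ⟩ (by simp)
    intro σ h
    by_cases hP : P.sat σ
    · exact h₂ σ (by simpa [hP] using h)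
    · simpa [hP] using h₁ σ h
  | negL P Γ Δ =>
    have h₁ := hps ⟨Γ, P :: Δ⟩ (by simp)
    intro σ h
    simp only [List.forall_mem_cons, Form.sat] at h
    simpa [h.1] using h₁ σ h.2
  | negR P Γ Δ =>
    have h₁ := hps ⟨P :: Γ, Δ⟩ (by simp)
    intro σ h
    by_cases hP : P.sat σ
    · obtain ⟨Q, hQ, hs⟩ := h₁ σ (by simpa [hP] using h)
      exact ⟨Q, List.mem_cons_of_mem _ hQ, hs⟩
    · exact ⟨_, List.mem_cons_self, hP⟩
  | andL P Q Γ Δ =>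
    have h₁ := hps ⟨P :: Q :: Γ, Δ⟩ (by simp)
    intro σ h
    simp only [List.forall_mem_cons, Form.sat] at h
    exact h₁ σ (by simpa [h.1] using h.2)
  | andR P Q Γ Δ =>
    have h₁ := hps ⟨Γ, P :: Δ⟩ (by simp)
    have h₂ := hps ⟨Γ, Q :: Δ⟩ (by simp)
    intro σ h
    have h₁ := h₁ σ h
    have h₂ := h₂ σ h
    simp only [List.exists_mem_cons_iff, Form.sat] at h₁ h₂ ⊢
    tauto
  | allR x P Γ Δ hΓ hΔ =>
    have h₁ := hps ⟨Γ, P :: Δ⟩ (by simp)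
    intro σ h
    have hne : ∀ r : ℝ, ∀ Q : Form, x ∉ Q.fv → (Q.sat (Function.update σ x r) ↔ Q.sat σ) :=
      fun r Q hQ => Form.sat_congr fun v hv =>
        Function.update_of_ne (by rintro rfl; exact hQ hv) _ _
    by_cases hall : ∀ r : ℝ, P.sat (Function.update σ x r)
    · exact ⟨_, List.mem_cons_self, hall⟩
    · push Not at hall
      obtain ⟨r, hr⟩ := hall
      -- The premise is used at a counterexample to the quantified formula. The side formulas do not
      -- mention `x`, so one in `Δ` holds there and already at `σ`.
      obtain ⟨Q, hQ, hs⟩ := h₁ (Function.update σ x r) fun Q hQ => (hne r Q (hΓ Q hQ)).2 (h Q hQ)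
      rcases List.mem_cons.1 hQ with rfl | hQ
      · exact absurd hs hr
      · exact ⟨Q, List.mem_cons_of_mem _ hQ, (hne r Q (hΔ Q hQ)).1 hs⟩

theorem Provable.valid {s : Sequent} (h : Provable s) : s.Valid := by
  induction h with
  | step ps s h _ ih => exact h.sound ih

end

end DAL

theorem theorem1 :
    (∀ P : DAL.Form, DAL.Ax P → P.Valid) ∧
    (∀ (ps : List DAL.Sequent) (s : DAL.Sequent), DAL.Rule ps s →
      (∀ p ∈ ps, p.Valid) → s.Valid) ∧
    (∀ s : DAL.Sequent, DAL.Provable s → s.Valid) :=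
  ⟨fun _ h => h.valid, fun _ _ h hps => h.sound hps, fun _ h => h.valid⟩
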